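/- Let $X$ be a Noetherian scheme and let $\mathcal{A}$ be an Azumaya algebra on $X$, i.e. a coherent sheaf of (associative, unital) $\mathcal{O}_X$-algebras which is, étale locally on $X$, isomorphic to a matrix algebra $M_n(\mathcal{O})$ with $n\ge 1$. Let $Z\subseteq X$ be a closed subset. Write $D(X)$ for the derived category of $\mathcal{O}_X$-modules and $D(\mathcal{A})$ for the derived category of right $\mathcal{A}$-modules, and let $D^b_{\mathrm{coh},Z}(X)\subseteq D(X)$ and $D^b_{\mathrm{coh},Z}(\mathcal{A})\subseteq D(\mathcal{A})$ be the strictly full triangulated subcategories of objects whose cohomology sheaves are coherent, supported in $Z$, and zero in all but finitely many degrees. An object $G$ of a triangulated category $\mathcal{T}$ is a classical generator if $\mathcal{T}$ is the smallest strictly full triangulated subcategory of $\mathcal{T}$ that contains $G$ and is closed under direct summands. Then the functor $-\otimes_{\mathcal{O}_X}\mathcal{A}$, applied to complexes term by term, induces a functor $\pi^\ast=-\otimes_{\mathcal{O}_X}\mathcal{A}\colon D(X)\to D(\mathcal{A})$, and if $G$ is a classical generator of $D^b_{\mathrm{coh},Z}(X)$, then $\pi^\ast G=G\otimes_{\mathcal{O}_X}\mathcal{A}$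 is a classical generator of $D^b_{\mathrm{coh},Z}(\mathcal{A})$. -/

import Mathlib

open CategoryTheory Limits TopologicalSpace Opposite AlgebraicGeometry
open scoped TensorProduct

universe w₁ w₂ u

noncomputable section

namespace AzumayaGen

/-! ### Opposite rings and extension of scalars -/

/-- The functor sending a ring to its opposite ring. -/
def ringOp : RingCat.{u} ⥤ RingCat.{u} where
  obj R := RingCat.of (R : Type u)ᵐᵒᵖ
  map f := RingCat.ofHom (RingHom.op f.hom)

/-- The opposite of a sheaf of rings (opposite multiplication on all sections). -/
def sheafOp {X : TopCat.{u}} (A : Sheaf (Opens.grothendieckTopology X) RingCat.{u}) :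
    Sheaf (Opens.grothendieckTopology X) RingCat.{u} where
  obj := A.obj ⋙ ringOp
  property := by
    refine (TopCat.Presheaf.isSheaf_iff_isSheaf_comp (forget RingCat.{u}) _).2 ?_
    refine TopCat.Presheaf.isSheaf_of_iso ?_
      ((TopCat.Presheaf.isSheaf_iff_isSheaf_comp (forget RingCat.{u}) _).1 A.property)
    exact NatIso.ofComponents (fun U => Equiv.toIso MulOpposite.opEquiv) (fun _ => rfl)

/-- Restriction of scalars along a morphism of sheaves of rings has a left adjoint
(extension of scalars). -/
theorem isRightAdjoint_restrictScalars {C : Type u} [Category.{u} C] {J : GrothendieckTopology C}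
    [HasWeakSheafify J AddCommGrpCat.{u}] [J.WEqualsLocallyBijective AddCommGrpCat.{u}]
    {S R : Sheaf J RingCat.{u}} (φ : S ⟶ R) :
    (SheafOfModules.restrictScalars.{u} φ).IsRightAdjoint := by
  have : (PresheafOfModules.pushforward.{u} (F := 𝟭 C) (R := R.obj) φ.hom).IsRightAdjoint :=
    inferInstance
  exact (SheafOfModules.PullbackConstruction.adjunction.{u}
    (F := 𝟭 C) (K := J) (R := R) φ).isRightAdjoint

/-! ### Coherent modules and supports -/

/-- A sheaf of modules on a (locally Noetherian) scheme is coherent if it is quasi-coherent and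
its sections over every affine open `U` form a finitely generated `Γ(X, U)`-module. -/
def IsCoherent {X : Scheme.{u}} (M : X.Modules) : Prop :=
  SheafOfModules.IsQuasicoherent M ∧
    ∀ U : X.Opens, IsAffineOpen U → Module.Finite Γ(X, U) Γ(M, U)

/-- The support of a sheaf of modules: the points at which the stalk does not vanish. -/
def support {X : Scheme.{u}} (M : X.Modules) : Set X :=
  {x | Nontrivial (TopCat.Presheaf.stalk (C := Ab.{u}) M.presheaf x : Ab.{u})}

/-- The `𝒪_X`-modules which are coherent and supported in `Z`. -/
def cohSupportedIn (X : Scheme.{u}) (Z : Set X) : ObjectProperty X.Modules :=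
  fun M => IsCoherent M ∧ support M ⊆ Z

/-! ### Sheaves of algebras on a scheme and their right modules -/

/-- A sheaf of (associative, unital, not necessarily commutative) `𝒪_X`-algebras:
a sheaf of rings with a morphism from `𝒪_X` with central image. -/
structure SheafOfAlgebras (X : Scheme.{u}) where
  /-- the underlying sheaf of rings -/
  ring : Sheaf (Opens.grothendieckTopology X) RingCat.{u}
  /-- the structure morphism -/
  str : X.ringCatSheaf ⟶ ring
  central (U : X.Opens) (r : Γ(X, U)) (a : ring.obj.obj (op U)) :
    str.hom.app (op U) r * a = a * str.hom.app (op U) r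

namespace SheafOfAlgebras

variable {X : Scheme.{u}} (𝒜 : SheafOfAlgebras X)

/-- The sections of `𝒜` over an open subset. -/
abbrev sections (U : X.Opens) : Type u := 𝒜.ring.obj.obj (op U)

/-- The sections of `𝒜` over `U` form an algebra over the sections of `𝒪_X` over `U`. -/
instance (U : X.Opens) : Algebra Γ(X, U) (𝒜.sections U) :=
  RingHom.toAlgebra' (𝒜.str.hom.app (op U)).hom (𝒜.central U)

/-- The structure morphism from `𝒪_X` into the opposite of `𝒜`. -/
def strOp : X.ringCatSheaf ⟶ sheafOp 𝒜.ring where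
  hom :=
    { app := fun U => RingCat.ofHom
        (RingHom.toOpposite (𝒜.str.hom.app U).hom (fun r _ => 𝒜.central U.unop r _))
      naturality := fun U V i => by
        ext r
        exact congrArg MulOpposite.op (ConcreteCategory.congr_hom (𝒜.str.hom.naturality i) r) }

/-- The category of right `𝒜`-modules, that is, of left modules over the opposite of `𝒜`. -/
abbrev Mod : Type (u + 1) := SheafOfModules.{u} (sheafOp 𝒜.ring)

/-- The forgetful functor from right `𝒜`-modules to `𝒪_X`-modules. -/
def forgetful : 𝒜.Mod ⥤ X.Modules := SheafOfModules.restrictScalars.{u} 𝒜.strOp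

instance : 𝒜.forgetful.IsRightAdjoint := isRightAdjoint_restrictScalars 𝒜.strOp

instance : 𝒜.forgetful.Additive where
  map_add := rfl

/-- The functor `M ↦ M ⊗_{𝒪_X} 𝒜` from `𝒪_X`-modules to right `𝒜`-modules
(the pullback along the structure morphism from `(X, 𝒜)` to `X`), that is,
the left adjoint of the forgetful functor. -/
def tensor : X.Modules ⥤ 𝒜.Mod := 𝒜.forgetful.leftAdjoint

/-- The extension of scalars is left adjoint to the forgetful functor. -/
def tensorAdjunction : 𝒜.tensor ⊣ 𝒜.forgetful := Adjunction.ofIsRightAdjoint 𝒜.forgetful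

instance : 𝒜.tensor.Additive := 𝒜.tensorAdjunction.left_adjoint_additive

/-- `𝒜` as an `𝒪_X`-module. -/
def toModules : X.Modules := 𝒜.forgetful.obj (SheafOfModules.unit (sheafOp 𝒜.ring))

/-- For `f : U ⟶ X` with `U` affine and with image in the affine open `V`, and `𝒜`
quasi-coherent, this says that `f^* 𝒜`, whose algebra of global sections
is `Γ(U) ⊗_{Γ(V)} 𝒜(V)`, is isomorphic to the algebra of `n × n` matrices over `𝒪_U`. -/
def PullbackIsMatrixAlgebra {U : Scheme.{u}} (f : U ⟶ X) (V : X.Opens)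
    (hf : (⊤ : U.Opens) ≤ f ⁻¹ᵁ V) (n : ℕ) : Prop :=
  letI : Algebra Γ(X, V) Γ(U, ⊤) := (f.appLE V ⊤ hf).hom.toAlgebra
  Nonempty ((Γ(U, ⊤) ⊗[Γ(X, V)] 𝒜.sections V) ≃ₐ[Γ(U, ⊤)] Matrix (Fin n) (Fin n) Γ(U, ⊤))

/-- An Azumaya algebra: a coherent sheaf of algebras which becomes, on an étale covering,
isomorphic to an algebra of `n × n` matrices with `n ≥ 1` (where `n` may vary). -/
structure IsAzumaya : Prop where
  coherent : IsCoherent 𝒜.toModules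
  etale_locally_split (x : X) : ∃ (U : Scheme.{u}) (f : U ⟶ X) (V : X.Opens)
    (hf : (⊤ : U.Opens) ≤ f ⁻¹ᵁ V) (n : ℕ),
    Etale f ∧ IsAffine U ∧ IsAffineOpen V ∧ x ∈ Set.range f ∧ 0 < n ∧
      𝒜.PullbackIsMatrixAlgebra f V hf n

/-- The termwise functor `K ↦ K ⊗_{𝒪_X} 𝒜` on cochain complexes. -/
def tensorComplex : CochainComplex X.Modules ℤ ⥤ CochainComplex 𝒜.Mod ℤ :=
  𝒜.tensor.mapHomologicalComplex (ComplexShape.up ℤ)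

end SheafOfAlgebras

/-! ### Derived categories and classical generators -/

/-- The objects of a derived category with bounded cohomology, all of it satisfying `P`. -/
def boundedWithCohomologyIn {C : Type*} [Category* C] [Abelian C] [HasDerivedCategory.{w₁} C]
    (P : ObjectProperty C) : ObjectProperty (DerivedCategory C) :=
  fun E => (∃ a b : ℤ, ∀ n : ℤ, n < a ∨ b < n →
      IsZero ((DerivedCategory.homologyFunctor C n).obj E)) ∧
    ∀ n : ℤ, P ((DerivedCategory.homologyFunctor C n).obj E)

/-- `D^b_{coh,Z}(X)`: the objects of the derived category of `𝒪_X`-modules with bounded and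
coherent cohomology supported in `Z`. -/
def DbCoh (X : Scheme.{u}) [HasDerivedCategory.{w₁} X.Modules] (Z : Set X) :
    ObjectProperty (DerivedCategory X.Modules) :=
  boundedWithCohomologyIn (cohSupportedIn X Z)

/-- `D^b_{coh,Z}(𝒜)`: the objects of the derived category of right `𝒜`-modules with bounded and
coherent cohomology supported in `Z`; an `𝒜`-module is coherent if it is so over `𝒪_X`
(`𝒜` being coherent). -/
def SheafOfAlgebras.DbCoh {X : Scheme.{u}} (𝒜 : SheafOfAlgebras X)
    [HasDerivedCategory.{w₁} 𝒜.Mod] (Z : Set X) : ObjectProperty (DerivedCategory 𝒜.Mod) :=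
  boundedWithCohomologyIn ((cohSupportedIn X Z).inverseImage 𝒜.forgetful)

/-- For a strictly full triangulated subcategory `𝒯` of `D` which is closed under direct summands,
`G` is a classical generator of `𝒯` if `𝒯` is the smallest such subcategory containing `G`. -/
def IsClassicalGenerator {D : Type*} [Category* D] [HasZeroObject D] [HasShift D ℤ]
    [Preadditive D] [∀ n : ℤ, (shiftFunctor D n).Additive] [Pretriangulated D]
    (𝒯 : ObjectProperty D) (G : D) : Prop :=
  (ObjectProperty.singleton G).triangEnvelope = 𝒯

end AzumayaGen

end

/-!
Write `T = - ⊗ 𝒜` for the extension of scalars and `π` for the forgetful functor, so that `T` is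
left adjoint to `π`. An Azumaya algebra is locally free over `𝒪_X`, so `T` is exact and preserves
coherence and supports; `π` is exact and faithful. Both functors pass to derived categories,
termwise on complexes, and the functor of the theorem is `T.mapDerivedCategory`.

Étale locally `𝒜` is a matrix algebra, which is separable: with `e = ∑ Eᵢ₀ ⊗ E₀ᵢ` one has `(a ⊗ 1)
e = e (1 ⊗ a)`, and multiplication maps `e` to `1`. The existence of such an element is the
solvability of a linear system, hence descends along flat maps, and `𝒜` is separable Zariski
locally (`exists_separability_of_flat`, `exists_separability`). In the same way freeness descends
(`exists_free_away_of_flat`, `exists_frame`). A separability element `∑ xₗ ⊗ yₗ` on an open subset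
`U` gives a natural splitting `p ↦ ∑ xₗ ⊗ yₗ p` of the counit `T π P ⟶ P` for the `𝒜`-modules `P`
supported in `U`. Local separability elements need not glue, but filtering a complex by its
subcomplexes of sections supported in finite unions of such open subsets exhibits every complex of
`𝒜`-modules as a finite extension of complexes at which the counit splits
(`filteredCounitSplit_of_cover`).

The conclusion is then formal (`isClassicalGenerator_mapDerivedCategory`). Let `𝒯` be the thick
subcategory generated by `T G` and let `E` be in `D^b_coh,Z(𝒜)`. For every `Y` in `D^b_coh,Z(𝒜)`
the object `π Y` is built from `G`, hence `T π Y` is in `𝒯`. If the counit splits at an object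
`K`, then every morphism `K ⟶ Y` factors through the counit `T π Y ⟶ Y`, so is killed by a map out
of `Y` with cone in `𝒯`. By successive annihilation this passes to finite extensions, hence holds
for `E`, although the pieces of the filtration of `E` need not be coherent. Applied to the identity of
`E`, it shows that `E` is a direct summand of an object of `𝒯`.

The sheaf-theoretic part works with sections over open subsets of a topological space: `Frame`
encodes a local basis of a sheaf of rings over another one, `Separability` a separability element.
On schemes, quasi-coherence is expressed by `IsLocalizingOn`: sections over `D(f)` are fractions
of sections.
-/

noncomputable section

namespace AzumayaGen

/-! ### Classical generators and adjunctions between derived categories -/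

section Triangulated

open Pretriangulated

variable {D : Type*} [Category* D] [HasZeroObject D] [HasShift D ℤ] [Preadditive D]
  [∀ n : ℤ, (shiftFunctor D n).Additive] [Pretriangulated D]

/-- `KilledBy 𝒯 𝒮 E` says that every morphism from `E` to an object of `𝒮` is annihilated by a
morphism in `𝒮` whose cone belongs to `𝒯`. -/
def KilledBy (𝒯 𝒮 : ObjectProperty D) (E : D) : Prop :=
  ∀ ⦃Y : D⦄, 𝒮 Y → ∀ h : E ⟶ Y, ∃ (Y' : D) (g : Y ⟶ Y'), 𝒮 Y' ∧ 𝒯.trW g ∧ h ≫ g = 0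

variable {𝒯 𝒮 : ObjectProperty D}

lemma KilledBy.of_iso {E E' : D} (e : E ≅ E') (hE : KilledBy 𝒯 𝒮 E) : KilledBy 𝒯 𝒮 E' := by
  intro Y hY h
  obtain ⟨Y', g, hY', hg, w⟩ := hE hY (e.hom ≫ h)
  exact ⟨Y', g, hY', hg, by rwa [Category.assoc, ← cancel_epi e.hom, comp_zero] at *⟩

/-- The objects all of whose morphisms to `𝒮` are annihilated are closed under extensions:
annihilate the restriction to the first object, factor through the third, annihilate again. -/
lemma KilledBy.ext [IsTriangulated D] [𝒯.IsTriangulated] {T : Triangle D} (hT : T ∈ distTriang D)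
    (h₁ : KilledBy 𝒯 𝒮 T.obj₁) (h₃ : KilledBy 𝒯 𝒮 T.obj₃) : KilledBy 𝒯 𝒮 T.obj₂ := by
  intro Y hY h
  obtain ⟨Y₁, g₁, hY₁, hg₁, w₁⟩ := h₁ hY (T.mor₁ ≫ h)
  obtain ⟨k, hk⟩ := Triangle.yoneda_exact₂ T hT (h ≫ g₁) (by rw [← Category.assoc, w₁])
  obtain ⟨Y₂, g₂, hY₂, hg₂, w₂⟩ := h₃ hY₁ k
  refine ⟨Y₂, g₁ ≫ g₂, hY₂, MorphismProperty.comp_mem _ _ _ hg₁ hg₂, ?_⟩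
  rw [← Category.assoc, hk, Category.assoc, w₂, comp_zero]

/-- If `ε : C ⟶ 𝟭` is a natural transformation with values of `C` on `𝒮` in `𝒯`, then morphisms
`h : E ⟶ Y` from an object `E` at which `ε` is split are annihilated by the cone
of `ε` at `Y`: they factor through `ε.app Y`. -/
lemma KilledBy.of_split [𝒯.IsStableUnderShift ℤ] [𝒮.IsTriangulated]
    [𝒮.IsClosedUnderIsomorphisms] (h𝒯𝒮 : 𝒯 ≤ 𝒮) {C : D ⥤ D} (ε : C ⟶ 𝟭 D)
    (hC : ∀ Y, 𝒮 Y → 𝒯 (C.obj Y)) {E : D} (s : E ⟶ C.obj E) (hs : s ≫ ε.app E = 𝟙 E) :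
    KilledBy 𝒯 𝒮 E := by
  intro Y hY h
  obtain ⟨Z, g, k, hT⟩ := distinguished_cocone_triangle (ε.app Y)
  refine ⟨Z, g, 𝒮.ext_of_isTriangulatedClosed₃ _ hT (h𝒯𝒮 _ (hC Y hY)) hY,
    ObjectProperty.trW.mk' 𝒯 hT (hC Y hY), ?_⟩
  have h₁ : ε.app Y ≫ g = 0 := comp_distTriang_mor_zero₁₂ _ hT
  have h₂ : C.map h ≫ ε.app Y = ε.app E ≫ h := ε.naturality h
  calc h ≫ g = s ≫ (ε.app E ≫ h) ≫ g := by rw [← Category.assoc, ← Category.assoc, hs,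
        Category.id_comp]
    _ = 0 := by rw [← h₂, Category.assoc, h₁, comp_zero, comp_zero]

/-- An object of `𝒮` whose identity is annihilated is a direct summand of an object
of `𝒯`. -/
lemma KilledBy.mem [𝒯.IsStableUnderShift ℤ] [𝒯.IsStableUnderRetracts] {E : D}
    (hE : KilledBy 𝒯 𝒮 E) (h : 𝒮 E) : 𝒯 E := by
  obtain ⟨Y, g, -, hg, w⟩ := hE h (𝟙 E)
  obtain ⟨X, f, k, hT, hX⟩ := (𝒯.trW_iff' g).1 hg
  obtain ⟨s, hs⟩ := Triangle.coyoneda_exact₂ _ hT (𝟙 E) w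
  exact ObjectProperty.prop_of_retract 𝒯 ⟨s, f, hs.symm⟩ hX

end Triangulated

section Derived

variable {A B : Type*} [Category* A] [Category* B] [Abelian A] [Abelian B]
  [HasDerivedCategory.{w₁} A] [HasDerivedCategory.{w₂} B]

/-- An exact functor commutes with the formation of cohomology objects. -/
lemma nonempty_homologyFunctor_mapDerivedCategory_iso (F : A ⥤ B) [F.Additive]
    [PreservesFiniteLimits F] [PreservesFiniteColimits F] (E : DerivedCategory A) (n : ℤ) :
    Nonempty ((DerivedCategory.homologyFunctor B n).obj (F.mapDerivedCategory.obj E) ≅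
      F.obj ((DerivedCategory.homologyFunctor A n).obj E)) := by
  have := Localization.essSurj (DerivedCategory.Q (C := A))
    (HomologicalComplex.quasiIso A (ComplexShape.up ℤ))
  let e := DerivedCategory.Q.objObjPreimageIso E
  let K := DerivedCategory.Q.objPreimage E
  exact ⟨(DerivedCategory.homologyFunctor B n).mapIso (F.mapDerivedCategory.mapIso e.symm) ≪≫
    (DerivedCategory.homologyFunctor B n).mapIso (F.mapDerivedCategoryFactors.app K) ≪≫
    (DerivedCategory.homologyFunctorFactors B n).app _ ≪≫
    (K.sc n).mapHomologyIso F ≪≫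
    F.mapIso ((DerivedCategory.homologyFunctorFactors A n).symm.app K ≪≫
      (DerivedCategory.homologyFunctor A n).mapIso e)⟩

lemma boundedWithCohomologyIn_mapDerivedCategory (F : A ⥤ B) [F.Additive]
    [PreservesFiniteLimits F] [PreservesFiniteColimits F] {P : ObjectProperty A}
    {P' : ObjectProperty B} [P'.IsClosedUnderIsomorphisms] (h : ∀ M, P M → P' (F.obj M))
    {E : DerivedCategory A} (hE : boundedWithCohomologyIn P E) :
    boundedWithCohomologyIn P' (F.mapDerivedCategory.obj E) := by
  obtain ⟨⟨a, b, hab⟩, hP⟩ := hE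
  refine ⟨⟨a, b, fun n hn => ?_⟩, fun n => ?_⟩
  · exact (F.map_isZero (hab n hn)).of_iso
      (nonempty_homologyFunctor_mapDerivedCategory_iso F E n).some
  · exact P'.prop_of_iso (nonempty_homologyFunctor_mapDerivedCategory_iso F E n).some.symm
      (h _ (hP n))

/-- For a faithful exact functor, boundedness of the cohomology can be tested on the image, since
such a functor reflects zero objects. -/
lemma boundedWithCohomologyIn_inverseImage (F : A ⥤ B) [F.Additive] [F.Faithful]
    [PreservesFiniteLimits F] [PreservesFiniteColimits F]
    (P : ObjectProperty B) [P.IsClosedUnderIsomorphisms] :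
    boundedWithCohomologyIn (P.inverseImage F) =
      (boundedWithCohomologyIn P).inverseImage F.mapDerivedCategory := by
  ext E
  refine ⟨boundedWithCohomologyIn_mapDerivedCategory F (fun _ h => h), fun hE => ?_⟩
  obtain ⟨⟨a, b, hab⟩, hP⟩ := hE
  refine ⟨⟨a, b, fun n hn => ?_⟩, fun n => ?_⟩
  · have := (hab n hn).of_iso (nonempty_homologyFunctor_mapDerivedCategory_iso F E n).some.symm
    rw [IsZero.iff_id_eq_zero] at this ⊢
    exact F.map_injective (by simpa using this)
  · exact P.prop_of_iso (nonempty_homologyFunctor_mapDerivedCategory_iso F E n).some (hP n)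

variable {T : A ⥤ B} {π : B ⥤ A} [T.Additive] [π.Additive]

/-- The counit of an adjunction of additive functors, termwise on complexes. -/
abbrev counitComplex (adj : T ⊣ π) :
    π.mapHomologicalComplex (ComplexShape.up ℤ) ⋙ T.mapHomologicalComplex (ComplexShape.up ℤ) ⟶
      𝟭 (CochainComplex B ℤ) where
  app K :=
    { f n := adj.counit.app (K.X n)
      comm' i j _ := (adj.counit.naturality (K.d i j)).symm }
  naturality K L f := by
    ext n
    exact adj.counit.naturality (f.f n)

/-- The complexes which are built by finitely many extensions out of complexes at which the
counit of the adjunction is split by a morphism of complexes. -/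
inductive FilteredCounitSplit (adj : T ⊣ π) : CochainComplex B ℤ → Prop
  | split (K : CochainComplex B ℤ) (s : ∀ n, K.X n ⟶ T.obj (π.obj (K.X n)))
      (hs : ∀ n, s n ≫ adj.counit.app (K.X n) = 𝟙 _)
      (comm : ∀ i j, s i ≫ T.map (π.map (K.d i j)) = K.d i j ≫ s j) : FilteredCounitSplit adj K
  | ext (S : ShortComplex (CochainComplex B ℤ)) (hS : S.ShortExact) :
      FilteredCounitSplit adj S.X₁ → FilteredCounitSplit adj S.X₃ → FilteredCounitSplit adj S.X₂

variable [PreservesFiniteLimits T] [PreservesFiniteColimits T]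
  [PreservesFiniteLimits π] [PreservesFiniteColimits π]

instance : Localization.Lifting DerivedCategory.Q
    (HomologicalComplex.quasiIso B (ComplexShape.up ℤ))
    (π.mapHomologicalComplex (ComplexShape.up ℤ) ⋙ T.mapHomologicalComplex (ComplexShape.up ℤ) ⋙
      DerivedCategory.Q) (π.mapDerivedCategory ⋙ T.mapDerivedCategory) where
  iso := Functor.isoWhiskerRight π.mapDerivedCategoryFactors T.mapDerivedCategory ≪≫
      Functor.isoWhiskerLeft (π.mapHomologicalComplex (ComplexShape.up ℤ))
        T.mapDerivedCategoryFactors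

/-- The counit of an adjunction of exact functors, on derived categories. -/
def counitDerived (adj : T ⊣ π) :
    π.mapDerivedCategory ⋙ T.mapDerivedCategory ⟶ 𝟭 (DerivedCategory B) :=
  Localization.liftNatTrans DerivedCategory.Q
    (HomologicalComplex.quasiIso B (ComplexShape.up ℤ))
    (π.mapHomologicalComplex (ComplexShape.up ℤ) ⋙ T.mapHomologicalComplex (ComplexShape.up ℤ) ⋙
      DerivedCategory.Q) DerivedCategory.Q _ _
    (Functor.whiskerRight (counitComplex adj) DerivedCategory.Q)

/-- A termwise splitting of the counit that commutes with the differentials gives a splitting of the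
derived counit at the class of the complex. -/
lemma exists_section_counitDerived (adj : T ⊣ π) (K : CochainComplex B ℤ)
    (s : ∀ n, K.X n ⟶ T.obj (π.obj (K.X n)))
    (hs : ∀ n, s n ≫ adj.counit.app (K.X n) = 𝟙 _)
    (comm : ∀ i j, s i ≫ T.map (π.map (K.d i j)) = K.d i j ≫ s j) :
    ∃ t : DerivedCategory.Q.obj K ⟶
        (π.mapDerivedCategory ⋙ T.mapDerivedCategory).obj (DerivedCategory.Q.obj K),
      t ≫ (counitDerived adj).app (DerivedCategory.Q.obj K) = 𝟙 _ := by
  let σ : K ⟶ (π.mapHomologicalComplex (ComplexShape.up ℤ) ⋙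
      T.mapHomologicalComplex (ComplexShape.up ℤ)).obj K :=
    { f := s, comm' := fun i j _ => comm i j }
  have hσ : σ ≫ (counitComplex adj).app K = 𝟙 K := by
    ext n
    exact hs n
  have hQ : DerivedCategory.Q.map σ ≫ DerivedCategory.Q.map ((counitComplex adj).app K) = 𝟙 _ := by
    rw [← Functor.map_comp, hσ, CategoryTheory.Functor.map_id]
  refine ⟨DerivedCategory.Q.map σ ≫ (Localization.Lifting.iso DerivedCategory.Q
    (HomologicalComplex.quasiIso B (ComplexShape.up ℤ))
    (π.mapHomologicalComplex (ComplexShape.up ℤ) ⋙ T.mapHomologicalComplex (ComplexShape.up ℤ) ⋙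
      DerivedCategory.Q) (π.mapDerivedCategory ⋙ T.mapDerivedCategory)).inv.app K, ?_⟩
  rw [counitDerived, Localization.liftNatTrans_app]
  simp only [Category.assoc, Iso.inv_hom_id_app_assoc]
  have : (Localization.Lifting.iso DerivedCategory.Q
    (HomologicalComplex.quasiIso B (ComplexShape.up ℤ)) DerivedCategory.Q
      (𝟭 (DerivedCategory B))).inv.app K = 𝟙 _ := rfl
  rw [this]
  simpa using hQ

/-- Transfer of classical generators along an exact left adjoint `T` of a faithful exact functor
`π`, when every complex is a finite extension of complexes at which the counit splits. Let `𝒯`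
be the envelope of `T G` and `𝒮` the category of the objects `E` with `π E` in the envelope of
`G`. Then `T (π E)` lies in `𝒯` for `E` in `𝒮`. If the counit splits at `E`, then every
morphism from `E` to an object of `𝒮` is annihilated by a morphism with cone in `𝒯`; this
property is stable under extensions, so all `E` have it, and for `E` in `𝒮` the identity of
`E` shows that `E` is in `𝒯`. The complexes in the extensions need not belong to `𝒮`. -/
theorem isClassicalGenerator_mapDerivedCategory (adj : T ⊣ π) [π.Faithful] (P : ObjectProperty A)
    [P.IsClosedUnderIsomorphisms] (hP : ∀ M, P M → P (π.obj (T.obj M)))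
    (hsplit : ∀ K : CochainComplex B ℤ, FilteredCounitSplit adj K)
    {G : DerivedCategory A} (hG : IsClassicalGenerator (boundedWithCohomologyIn P) G) :
    IsClassicalGenerator (boundedWithCohomologyIn (P.inverseImage π))
      (T.mapDerivedCategory.obj G) := by
  unfold IsClassicalGenerator at *
  set 𝒯 := (ObjectProperty.singleton (T.mapDerivedCategory.obj G)).triangEnvelope
  rw [boundedWithCohomologyIn_inverseImage, ← hG]
  have htri : (ObjectProperty.singleton G).triangEnvelope.IsTriangulated := inferInstance
  set 𝒮₀ := (ObjectProperty.singleton G).triangEnvelope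
  set 𝒮 := 𝒮₀.inverseImage π.mapDerivedCategory with h𝒮
  have h𝒮ret : 𝒮.IsStableUnderRetracts :=
    ⟨fun r h => ObjectProperty.prop_of_retract 𝒮₀ (r.map π.mapDerivedCategory) h⟩
  have h₁ : 𝒮₀ ≤ 𝒯.inverseImage T.mapDerivedCategory := by
    have : (𝒯.inverseImage T.mapDerivedCategory).IsStableUnderRetracts :=
      ⟨fun r h => ObjectProperty.prop_of_retract 𝒯 (r.map T.mapDerivedCategory) h⟩
    rw [ObjectProperty.triangEnvelope_le_iff]
    rintro _ ⟨⟩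
    exact ObjectProperty.le_triangEnvelope _ _ ⟨()⟩
  have h₂ : 𝒯 ≤ 𝒮 := by
    rw [ObjectProperty.triangEnvelope_le_iff]
    rintro _ ⟨⟩
    have hG' : 𝒮₀ G := ObjectProperty.le_triangEnvelope _ _ ⟨()⟩
    rw [hG] at hG'
    have := boundedWithCohomologyIn_mapDerivedCategory (P' := P.inverseImage π) T hP hG'
    rw [boundedWithCohomologyIn_inverseImage, ← hG] at this
    exact this
  refine le_antisymm h₂ fun E hE => ?_
  have := Localization.essSurj (DerivedCategory.Q (C := B))
    (HomologicalComplex.quasiIso B (ComplexShape.up ℤ))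
  refine (KilledBy.of_iso (DerivedCategory.Q.objObjPreimageIso E) ?_).mem hE
  have key := hsplit (DerivedCategory.Q.objPreimage E)
  generalize DerivedCategory.Q.objPreimage E = K at key
  induction key with
  | split K s hs comm =>
    obtain ⟨t, ht⟩ := exists_section_counitDerived adj K s hs comm
    exact KilledBy.of_split h₂ (counitDerived adj) (fun Y hY => h₁ _ hY) t ht
  | ext S hS _ _ ih₁ ih₃ =>
    exact KilledBy.ext (DerivedCategory.triangleOfSES_distinguished hS) ih₁ ih₃

end Derived

/-! ### Descent of freeness and separability along flat ring maps -/

section CommutativeAlgebra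

/-- Freeness of a finite module descends along a flat ring map, in a neighbourhood of any prime
in the image of the spectrum. -/
lemma exists_free_away_of_flat {R B : Type u} [CommRing R] [IsNoetherianRing R] [CommRing B]
    [Algebra R B] [Module.Flat R B] (M : Type u) [AddCommGroup M] [Module R M] [Module.Finite R M]
    [Module.Flat B (B ⊗[R] M)] (q : Ideal B) [q.IsPrime] :
    ∃ f ∉ q.comap (algebraMap R B),
      Module.Free (Localization (Submonoid.powers f)) (LocalizedModule.Away f M) := by
  set p := q.comap (algebraMap R B) with hp
  let Rp := Localization.AtPrime p
  let Bq := Localization.AtPrime q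
  let : Algebra Rp Bq := (Localization.localRingHom p q (algebraMap R B) hp).toAlgebra
  have : IsScalarTower R Rp Bq := .of_algebraMap_eq fun x =>
    (by
      rw [IsScalarTower.algebraMap_apply R B Bq]
      exact (Localization.localRingHom_to_map p q (algebraMap R B) hp x).symm)
  have : Module.Flat Rp Bq :=
    RingHom.Flat.localRingHom (f := algebraMap R B)
      (by rwa [RingHom.flat_algebraMap_iff]) q p hp
  have : IsLocalHom (algebraMap Rp Bq) :=
    Localization.isLocalHom_localRingHom p q (algebraMap R B) hp
  have : Module.FaithfullyFlat Rp Bq := Module.FaithfullyFlat.of_flat_of_isLocalHom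
  have e₁ : Bq ⊗[B] (B ⊗[R] M) ≃ₗ[Bq] Bq ⊗[R] M :=
    TensorProduct.AlgebraTensorModule.cancelBaseChange R B Bq Bq M
  have e₂ : Bq ⊗[Rp] (Rp ⊗[R] M) ≃ₗ[Bq] Bq ⊗[R] M :=
    TensorProduct.AlgebraTensorModule.cancelBaseChange R Rp Bq Bq M
  have : Module.Flat Bq (Bq ⊗[Rp] (Rp ⊗[R] M)) := .of_linearEquiv (e₂.trans e₁.symm)
  have : Module.Flat Rp (Rp ⊗[R] M) := (Module.Flat.iff_flat_tensorProduct Rp _ Bq).1 this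
  have : Module.Free Rp (Rp ⊗[R] M) := Module.free_of_flat_of_isLocalRing
  have : Module.FinitePresentation R M := Module.finitePresentation_of_finite R M
  obtain ⟨f, hf, hfree, -⟩ := Module.FinitePresentation.exists_free_localizedModule_powers
    p.primeCompl (TensorProduct.mk R Rp M 1) Rp
  exact ⟨f, hf, hfree⟩

open Algebra.TensorProduct in
/-- Separability descends along a flat ring map, in a neighbourhood of any prime
in the image of the spectrum: if `B ⊗ A` is a matrix algebra, then `A ⊗ A` contains an element `e`
with `a e = e a` for `a ∈ A` and with image `f` in `A`, for some `f` not in the given prime.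
Over `B` one takes `∑ Eᵢ₀ ⊗ E₀ᵢ`, and the space of solutions of a linear system is compatible
with flat base change. -/
lemma exists_separability_of_flat {R B A : Type u} [CommRing R] [CommRing B] [Algebra R B]
    [Module.Flat R B] [Ring A] [Algebra R A] [Module.Finite R A] {n : ℕ} (hn : 0 < n)
    (ψ : B ⊗[R] A ≃ₐ[B] Matrix (Fin n) (Fin n) B) (q : Ideal B) [q.IsPrime] :
    ∃ f ∉ q.comap (algebraMap R B), ∃ e : A ⊗[R] A,
      (∀ a : A, (a ⊗ₜ[R] (1 : A)) * e = e * ((1 : A) ⊗ₜ[R] a)) ∧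
        LinearMap.mul' R A e = algebraMap R A f := by
  classical
  obtain ⟨m, a, ha⟩ := Module.Finite.exists_fin (R := R) (M := A)
  let C := A ⊗[R] A
  let i₁ : A →ₐ[R] C := includeLeft
  let i₂ : A →ₐ[R] C := includeRight
  let δ (x : A) : C →ₗ[R] C := LinearMap.mulLeft R (i₁ x) - LinearMap.mulRight R (i₂ x)
  let Φ : (C × R) →ₗ[R] A × (Fin m → C) :=
    LinearMap.prod ((LinearMap.mul' R A).coprod (-(Algebra.linearMap R A)))
      (LinearMap.pi fun k => δ (a k) ∘ₗ LinearMap.fst R C R)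
  let j₁ : B ⊗[R] A →ₐ[B] B ⊗[R] C := Algebra.TensorProduct.map (AlgHom.id B B) i₁
  let j₂ : B ⊗[R] A →ₐ[B] B ⊗[R] C := Algebra.TensorProduct.map (AlgHom.id B B) i₂
  let g₁ := j₁.comp ψ.symm.toAlgHom
  let g₂ := j₂.comp ψ.symm.toAlgHom
  let o : Fin n := ⟨0, hn⟩
  let E (i j : Fin n) : Matrix (Fin n) (Fin n) B := Matrix.single i j 1
  let eB : B ⊗[R] C := ∑ i, g₁ (E i o) * g₂ (E o i)
  have hcomm (N : Matrix (Fin n) (Fin n) B) : g₁ N * eB = eB * g₂ N := by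
    have h₁ (i : Fin n) : N * E i o = ∑ k, N k i • E k o := by
      ext r s
      simp [E, Matrix.mul_apply, Matrix.sum_apply, Matrix.single_apply, ite_and]
    have h₂ (k : Fin n) : E o k * N = ∑ i, N k i • E o i := by
      ext r s
      simp [E, Matrix.mul_apply, Matrix.sum_apply, Matrix.single_apply, ite_and]
    simp only [eB, Finset.mul_sum, Finset.sum_mul, ← mul_assoc, ← map_mul, h₁]
    simp only [mul_assoc, ← map_mul, h₂, map_sum, map_smul, Finset.sum_mul, Finset.mul_sum,
      smul_mul_assoc, mul_smul_comm]
    exact Finset.sum_comm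
  have hμ (x y : B ⊗[R] A) : (LinearMap.mul' R A).lTensor B (j₁ x * j₂ y) = x * y := by
    induction x with
    | zero => simp
    | add x x' hx hx' => simp [add_mul, hx, hx']
    | tmul b x =>
      induction y with
      | zero => simp
      | add y y' hy hy' => rw [map_add, mul_add, mul_add, map_add, hy, hy']
      | tmul b' y =>
        have h : LinearMap.mul' R A (i₁ x * i₂ y) = x * y := by
          change LinearMap.mul' R A ((x ⊗ₜ 1) * (1 ⊗ₜ y)) = _
          simp
        simp [j₁, j₂, h]
  have hμe : (LinearMap.mul' R A).lTensor B eB = 1 := by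
    have : ∑ i, E i o * E o i = 1 := by
      ext r s
      simp [E, Matrix.sum_apply, Matrix.single_apply, Matrix.one_apply, ite_and]
    simp only [eB, g₁, g₂, AlgHom.comp_apply, map_sum, hμ]
    rw [← map_one ψ.symm, ← this, map_sum]
    exact Finset.sum_congr rfl fun i _ => (map_mul ψ.symm _ _).symm
  have hδ (x : A) : (δ x).lTensor B eB = 0 := by
    have h (z : B ⊗[R] C) : (δ x).lTensor B z = j₁ (1 ⊗ₜ x) * z - z * j₂ (1 ⊗ₜ x) := by
      induction z with
      | zero => simp
      | add z z' hz hz' => rw [map_add, hz, hz', mul_add, add_mul]; abel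
      | tmul b z => simp [j₁, j₂, δ]
    have := hcomm (ψ (1 ⊗ₜ x))
    simp only [g₁, g₂, AlgHom.comp_apply] at this
    rw [h, sub_eq_zero]
    simpa using this
  -- the solution over `B`, homogenised by the last coordinate
  let z : B ⊗[R] (C × R) := (LinearMap.inl R C R).lTensor B eB + 1 ⊗ₜ ((0 : C), (1 : R))
  have hz : Φ.lTensor B z = 0 := by
    apply (TensorProduct.prodRight R R B A (Fin m → C)).injective
    refine Prod.ext ?_ ?_
    · have h (z : B ⊗[R] (A × (Fin m → C))) : (TensorProduct.prodRight R R B A (Fin m → C) z).1 =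
          (LinearMap.fst R A (Fin m → C)).lTensor B z := by
        induction z with
        | zero => simp
        | add z z' hz hz' => simp [hz, hz']
        | tmul b z => simp
      rw [h, ← LinearMap.comp_apply, ← LinearMap.lTensor_comp, map_zero, Prod.fst_zero, map_add,
        ← LinearMap.comp_apply, ← LinearMap.lTensor_comp]
      have : (LinearMap.fst R A (Fin m → C) ∘ₗ Φ) ∘ₗ LinearMap.inl R C R = LinearMap.mul' R A := by
        ext; simp [Φ]
      rw [this, hμe]
      simp [Φ, Algebra.TensorProduct.one_def, ← TensorProduct.tmul_add]
    · apply (TensorProduct.piRight R R B (fun _ : Fin m => C)).injective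
      funext k
      have h (z : B ⊗[R] (A × (Fin m → C))) : TensorProduct.piRight R R B (fun _ : Fin m => C)
          (TensorProduct.prodRight R R B A (Fin m → C) z).2 k =
          (LinearMap.proj k ∘ₗ LinearMap.snd R A (Fin m → C)).lTensor B z := by
        induction z with
        | zero => simp
        | add z z' hz hz' => simp only [map_add, Prod.snd_add, Pi.add_apply, hz, hz']
        | tmul b z => simp
      rw [h, ← LinearMap.comp_apply, ← LinearMap.lTensor_comp, map_zero, Prod.snd_zero, map_zero,
        map_add, ← LinearMap.comp_apply, ← LinearMap.lTensor_comp]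
      have : ((LinearMap.proj k ∘ₗ LinearMap.snd R A (Fin m → C)) ∘ₗ Φ) ∘ₗ LinearMap.inl R C R =
          δ (a k) := by
        exact LinearMap.ext fun x => rfl
      rw [this, hδ]
      simp [Φ]
  obtain ⟨w, hw⟩ := (Module.Flat.lTensor_exact B (LinearMap.exact_subtype_ker_map Φ) z).1 hz
  have hq : q ≠ ⊤ := Ideal.IsPrime.ne_top inferInstance
  by_contra! hcon
  -- otherwise the last coordinate of every solution over `R` lies in the prime
  have key (v : B ⊗[R] LinearMap.ker Φ) :
      Algebra.TensorProduct.rid R B B ((LinearMap.snd R C R ∘ₗ (LinearMap.ker Φ).subtype).lTensor B v)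
        ∈ q := by
    induction v with
    | zero => simp
    | add v v' hv hv' => simpa using q.add_mem hv hv'
    | tmul b v =>
      obtain ⟨⟨e, t⟩, hv⟩ := v
      have hv' : LinearMap.mul' R A e = algebraMap R A t ∧ ∀ k, i₁ (a k) * e = e * i₂ (a k) := by
        have := LinearMap.mem_ker.1 hv
        simp only [Φ, Prod.ext_iff, funext_iff] at this
        simpa [δ, sub_eq_zero, ← sub_eq_add_neg] using this
      have ht : algebraMap R B t ∈ q := by
        by_contra ht
        refine hcon t ht e (fun x => ?_) hv'.1
        have hx : x ∈ Submodule.span R (Set.range a) := ha ▸ Submodule.mem_top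
        change i₁ x * e = e * i₂ x
        induction hx using Submodule.span_induction with
        | mem x hx => obtain ⟨k, rfl⟩ := hx; exact hv'.2 k
        | zero => simp
        | add x y _ _ hx hy => rw [map_add, map_add, add_mul, mul_add, hx, hy]
        | smul r x _ hx => rw [map_smul, map_smul, smul_mul_assoc, mul_smul_comm, hx]
      simpa [Algebra.smul_def, mul_comm] using q.mul_mem_left b ht
  refine hq ((Ideal.eq_top_iff_one q).2 ?_)
  have h := key w
  rw [LinearMap.lTensor_comp, LinearMap.comp_apply, hw, map_add, ← LinearMap.comp_apply,
    ← LinearMap.lTensor_comp] at h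
  simpa [LinearMap.snd_comp_inl] using h

end CommutativeAlgebra

/-! ### Sections of sheaves of modules -/

section Sections

variable {X : TopCat.{u}} {R S : Sheaf (Opens.grothendieckTopology X) RingCat.{u}}

/-- The ring of sections of a sheaf of rings over an open subset. -/
abbrev RSec (R : Sheaf (Opens.grothendieckTopology X) RingCat.{u}) (U : Opens X) : Type u :=
  R.obj.obj (op U)

/-- Restriction of sections of a sheaf of rings. -/
def rres (R : Sheaf (Opens.grothendieckTopology X) RingCat.{u}) {U V : Opens X} (h : V ≤ U) :
    RSec R U →+* RSec R V :=
  (R.obj.map (homOfLE h).op).hom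

@[simp]
lemma rres_rres {U V W : Opens X} (h : V ≤ U) (h' : W ≤ V) (r : RSec R U) :
    rres R h' (rres R h r) = rres R (h'.trans h) r :=
  (ConcreteCategory.congr_hom (R.obj.map_comp (homOfLE h).op (homOfLE h').op) r).symm

@[simp]
lemma rres_self {U : Opens X} (r : RSec R U) : rres R le_rfl r = r :=
  ConcreteCategory.congr_hom (R.obj.map_id (op U)) r

/-- The action of a morphism of sheaves of rings on sections. -/
def rapp (φ : R ⟶ S) (U : Opens X) : RSec R U →+* RSec S U := (φ.hom.app (op U)).hom

@[simp]
lemma rres_rapp (φ : R ⟶ S) {U V : Opens X} (h : V ≤ U) (r : RSec R U) :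
    rres S h (rapp φ U r) = rapp φ V (rres R h r) :=
  (ConcreteCategory.congr_hom (φ.hom.naturality (homOfLE h).op) r).symm

/-- The module of sections of a sheaf of modules over an open subset. -/
abbrev Sec (M : SheafOfModules.{u} R) (U : Opens X) : Type u := M.val.obj (op U)

variable {M N P : SheafOfModules.{u} R}

/-- Restriction of sections of a sheaf of modules. -/
def res (M : SheafOfModules.{u} R) {U V : Opens X} (h : V ≤ U) : Sec M U →+ Sec M V where
  toFun := M.val.map (homOfLE h).op
  map_zero' := map_zero (M.val.map (homOfLE h).op).hom
  map_add' := map_add (M.val.map (homOfLE h).op).hom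

@[simp]
lemma res_smul {U V : Opens X} (h : V ≤ U) (r : RSec R U) (m : Sec M U) :
    res M h (r • m) = rres R h r • res M h m :=
  M.val.map_smul (homOfLE h).op r m

@[simp]
lemma res_res {U V W : Opens X} (h : V ≤ U) (h' : W ≤ V) (m : Sec M U) :
    res M h' (res M h m) = res M (h'.trans h) m :=
  (M.val.map_comp_apply (homOfLE h).op (homOfLE h').op m).symm

@[simp]
lemma res_self {U : Opens X} (m : Sec M U) : res M le_rfl m = m :=
  ConcreteCategory.congr_hom (M.val.presheaf.map_id (op U)) m

/-- The action of a morphism of sheaves of modules on sections. -/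
def sapp (f : M ⟶ N) (U : Opens X) : Sec M U →ₗ[RSec R U] Sec N U := (f.val.app (op U)).hom

@[simp]
lemma res_sapp (f : M ⟶ N) {U V : Opens X} (h : V ≤ U) (m : Sec M U) :
    res N h (sapp f U m) = sapp f V (res M h m) :=
  (PresheafOfModules.naturality_apply f.val (homOfLE h).op m).symm

@[simp]
lemma sapp_comp (f : M ⟶ N) (g : N ⟶ P) (U : Opens X) (m : Sec M U) :
    sapp (f ≫ g) U m = sapp g U (sapp f U m) := rfl

@[simp]
lemma sapp_id (U : Opens X) (m : Sec M U) : sapp (𝟙 M) U m = m := rfl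

lemma hom_ext_sapp {f g : M ⟶ N} (h : ∀ U m, sapp f U m = sapp g U m) : f = g := by
  apply SheafOfModules.hom_ext
  ext U m
  exact h U.unop m

lemma mono_of_injective_sapp (f : M ⟶ N) (h : ∀ U, Function.Injective (sapp f U)) : Mono f where
  right_cancellation g g' w := hom_ext_sapp fun U m =>
    h U (by rw [← sapp_comp, w, sapp_comp])

lemma zero_sapp (U : Opens X) (m : Sec M U) : sapp (0 : M ⟶ N) U m = 0 := rfl

/-- Constructor for morphisms of sheaves of modules. -/
def homMkSec (f : ∀ U, Sec M U → Sec N U) (hadd : ∀ U m m', f U (m + m') = f U m + f U m')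
    (hsmul : ∀ U (r : RSec R U) m, f U (r • m) = r • f U m)
    (hres : ∀ {U V} (h : V ≤ U) m, res N h (f U m) = f V (res M h m)) : M ⟶ N where
  val :=
    { app U := ModuleCat.ofHom
        { toFun := f U.unop, map_add' := hadd U.unop, map_smul' := hsmul U.unop }
      naturality {U V} i := by
        ext m
        exact (hres (leOfHom i.unop) m).symm }

lemma sec_ext {U : Opens X} {s t : Sec M U}
    (h : ∀ x ∈ U, ∃ (V : Opens X) (hV : V ≤ U), x ∈ V ∧ res M hV s = res M hV t) : s = t := by
  choose V hV hx e using h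
  refine TopCat.Sheaf.eq_of_locally_eq' (F := ⟨M.val.presheaf, M.isSheaf⟩)
    (fun x : U => V x.1 x.2) U (fun x => homOfLE (hV x.1 x.2)) ?_ s t (fun x => e x.1 x.2)
  intro x hxU
  exact Opens.mem_iSup.2 ⟨⟨x, hxU⟩, hx x hxU⟩

lemma exists_glue {ι : Type u} {U : Opens X} (V : ι → Opens X) (hV : ∀ i, V i ≤ U)
    (hU : U ≤ iSup V) (s : ∀ i, Sec M (V i))
    (hs : ∀ i j, res M (inf_le_left : V i ⊓ V j ≤ V i) (s i) =
      res M (inf_le_right : V i ⊓ V j ≤ V j) (s j)) :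
    ∃ t : Sec M U, ∀ i, res M (hV i) t = s i := by
  let F : TopCat.Sheaf Ab.{u} X := ⟨M.val.presheaf, M.isSheaf⟩
  let s' (i : ι) : ToType (F.obj.obj (op (V i))) := s i
  have hs' : TopCat.Presheaf.IsCompatible F.obj V s' := hs
  obtain ⟨t, ht, -⟩ := F.existsUnique_gluing' V U (fun i => homOfLE (hV i)) hU s' hs'
  exact ⟨t, ht⟩

/-- Constructor for sheaves of modules out of the sheaf condition for sections. -/
def ofSec (F : (Opens X)ᵒᵖ ⥤ Ab.{u}) [∀ U, Module (R.obj.obj U) (F.obj U)]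
    (map_smul : ∀ ⦃U V⦄ (i : U ⟶ V) (r : R.obj.obj U) (m : F.obj U),
      F.map i (r • m) = R.obj.map i r • F.map i m)
    (hF : TopCat.Presheaf.IsSheafUniqueGluing (F ⋙ forget Ab)) : SheafOfModules.{u} R where
  val := PresheafOfModules.ofPresheaf F map_smul
  isSheaf := (TopCat.Presheaf.isSheaf_iff_isSheaf_comp (forget Ab.{u}) _).2
    (TopCat.Presheaf.isSheaf_of_isSheafUniqueGluing_types _ hF)

/-- A subsheaf of modules: a family of submodules of the modules of sections
which is stable under restriction and local. -/
structure Subsheaf (M : SheafOfModules.{u} R) where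
  /-- the submodule of sections over `U` -/
  carrier (U : Opens X) : Submodule (RSec R U) (Sec M U)
  res_mem {U V : Opens X} (h : V ≤ U) {m : Sec M U} : m ∈ carrier U → res M h m ∈ carrier V
  local_mem {U : Opens X} {m : Sec M U} :
    (∀ x ∈ U, ∃ (V : Opens X) (h : V ≤ U), x ∈ V ∧ res M h m ∈ carrier V) → m ∈ carrier U

namespace Subsheaf

variable (D : Subsheaf M)

/-- The presheaf of modules of sections of a subsheaf. -/
def toPresheafSubmodule : PresheafOfModules.Submodule M.val where
  obj U := D.carrier U.unop
  map f _ hm := D.res_mem (leOfHom f.unop) hm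

/-- A subsheaf as a sheaf of modules. -/
def toSheafOfModules : SheafOfModules.{u} R where
  val := D.toPresheafSubmodule.toPresheafOfModules
  isSheaf := by
    refine (TopCat.Presheaf.isSheaf_iff_isSheaf_comp (forget Ab.{u}) _).2
      (TopCat.Presheaf.isSheaf_of_isSheafUniqueGluing_types _ fun ι V sf hsf => ?_)
    let s (i : ι) : Sec M (V i) := (show D.carrier (V i) from sf i).1
    obtain ⟨t, ht⟩ := exists_glue V (le_iSup V) le_rfl s
      (fun i j => congrArg (fun z : D.carrier (V i ⊓ V j) => z.1) (hsf i j))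
    have htm : t ∈ D.carrier (iSup V) := D.local_mem fun x hx => by
      obtain ⟨i, hi⟩ := Opens.mem_iSup.1 hx
      exact ⟨V i, le_iSup V i, hi, by rw [ht]; exact (show D.carrier (V i) from sf i).2⟩
    refine ⟨(⟨t, htm⟩ : D.carrier (iSup V)), fun i => Subtype.ext (ht i), fun t' ht' => ?_⟩
    refine Subtype.ext (sec_ext fun x hx => ?_)
    obtain ⟨i, hi⟩ := Opens.mem_iSup.1 hx
    exact ⟨V i, le_iSup V i, hi,
      (congrArg (fun z : D.carrier (V i) => z.1) (ht' i)).trans (ht i).symm⟩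

/-- The inclusion of a subsheaf. -/
def ι : D.toSheafOfModules ⟶ M where
  val := D.toPresheafSubmodule.ι

lemma sapp_ι_mem (U : Opens X) (m : Sec D.toSheafOfModules U) : sapp D.ι U m ∈ D.carrier U :=
  (show D.carrier U from m).2

lemma sapp_ι_injective (U : Opens X) : Function.Injective (sapp D.ι U) := Subtype.val_injective

lemma exists_sapp_ι_eq {U : Opens X} {m : Sec M U} (hm : m ∈ D.carrier U) :
    ∃ m' : Sec D.toSheafOfModules U, sapp D.ι U m' = m :=
  ⟨(⟨m, hm⟩ : D.carrier U), rfl⟩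

instance : Mono D.ι := mono_of_injective_sapp _ D.sapp_ι_injective

lemma exists_lift (f : N ⟶ M) (hf : ∀ U n, sapp f U n ∈ D.carrier U) :
    ∃ g : N ⟶ D.toSheafOfModules, g ≫ D.ι = f := by
  refine ⟨homMkSec (fun U n => (⟨sapp f U n, hf U n⟩ : D.carrier U)) (fun U m m' => ?_)
    (fun U r m => ?_) (fun h m => ?_), rfl⟩
  · exact Subtype.ext (map_add (sapp f U) m m')
  · exact Subtype.ext (map_smul (sapp f U) r m)
  · exact Subtype.ext (res_sapp f h m)

end Subsheaf

/-- The image of a morphism of sheaves of modules. -/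
def imageSubsheaf (f : M ⟶ N) : Subsheaf N where
  carrier U :=
    { carrier := {n | ∀ x ∈ U, ∃ (V : Opens X) (h : V ≤ U), x ∈ V ∧
        ∃ m : Sec M V, sapp f V m = res N h n}
      zero_mem' := fun x hx => ⟨U, le_rfl, hx, 0, by simp⟩
      add_mem' := fun {n n'} hn hn' x hx => by
        obtain ⟨V, h, hxV, m, hm⟩ := hn x hx
        obtain ⟨V', h', hxV', m', hm'⟩ := hn' x hx
        refine ⟨V ⊓ V', inf_le_left.trans h, ⟨hxV, hxV'⟩,
          res M inf_le_left m + res M inf_le_right m', ?_⟩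
        rw [map_add, map_add, ← res_sapp, ← res_sapp, hm, hm', res_res, res_res]
      smul_mem' := fun r n hn x hx => by
        obtain ⟨V, h, hxV, m, hm⟩ := hn x hx
        exact ⟨V, h, hxV, rres R h r • m, by rw [map_smul, hm, res_smul]⟩ }
  res_mem {U V} h n hn x hx := by
    obtain ⟨W, h', hxW, m, hm⟩ := hn x (h hx)
    exact ⟨W ⊓ V, inf_le_right, ⟨hxW, hx⟩, res M inf_le_left m,
      by rw [← res_sapp, hm, res_res, res_res]⟩
  local_mem {U n} hn x hx := by
    obtain ⟨V, h, hxV, hn'⟩ := hn x hx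
    obtain ⟨W, h', hxW, m, hm⟩ := hn' x hxV
    exact ⟨W, h'.trans h, hxW, m, by rw [hm, res_res]⟩

lemma exists_local_preimage_of_epi (f : M ⟶ N) [Epi f] {U : Opens X} (n : Sec N U) {x : X}
    (hx : x ∈ U) : ∃ (V : Opens X) (h : V ≤ U), x ∈ V ∧ ∃ m : Sec M V, sapp f V m = res N h n := by
  obtain ⟨g, hg⟩ := (imageSubsheaf f).exists_lift f
    (fun U m x hx => ⟨U, le_rfl, hx, m, by simp⟩)
  have : Epi (imageSubsheaf f).ι := epi_of_epi_fac hg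
  have : IsIso (imageSubsheaf f).ι := isIso_of_mono_of_epi _
  have h := (imageSubsheaf f).sapp_ι_mem U (sapp (inv (imageSubsheaf f).ι) U n)
  rw [← sapp_comp, IsIso.inv_hom_id, sapp_id] at h
  exact h x hx

lemma epi_of_local_preimage (f : M ⟶ N) (h : ∀ (U : Opens X) (n : Sec N U), ∀ x ∈ U,
    ∃ (V : Opens X) (h : V ≤ U), x ∈ V ∧ ∃ m : Sec M V, sapp f V m = res N h n) : Epi f where
  left_cancellation g g' w := hom_ext_sapp fun U n => sec_ext fun x hx => by
    obtain ⟨V, hV, hxV, m, hm⟩ := h U n x hx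
    refine ⟨V, hV, hxV, ?_⟩
    rw [res_sapp, res_sapp, ← hm, ← sapp_comp, w, sapp_comp]

lemma injective_sapp_of_mono (f : M ⟶ N) [Mono f] (U : Opens X) :
    Function.Injective (sapp f U) := by
  have h : Mono ((SheafOfModules.forget R ⋙ PresheafOfModules.evaluation R.obj (op U)).map f) :=
    inferInstance
  exact (ModuleCat.mono_iff_injective _).1 h

end Sections

/-! ### Extension of scalars along a locally free sheaf of rings -/

section ExtensionOfScalars

variable {X : TopCat.{u}} {R S : Sheaf (Opens.grothendieckTopology X) RingCat.{u}} {φ : R ⟶ S}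
  {T : SheafOfModules.{u} R ⥤ SheafOfModules.{u} S}
  (adj : T ⊣ SheafOfModules.restrictScalars.{u} φ)
  {M N : SheafOfModules.{u} R} {P : SheafOfModules.{u} S} {U V W : Opens X}

/-- The canonical map `n ↦ 1 ⊗ n` from `N` to its extension of scalars, on sections. -/
def tensorOne (N : SheafOfModules.{u} R) (W : Opens X) : Sec N W →+ Sec (T.obj N) W :=
  (sapp (adj.unit.app N) W).toAddMonoidHom

lemma tensorOne_smul (r : RSec R W) (n : Sec N W) :
    tensorOne adj N W (r • n) = rapp φ W r • tensorOne adj N W n :=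
  (sapp (adj.unit.app N) W).map_smul r n

@[simp]
lemma res_tensorOne (h : V ≤ W) (n : Sec N W) :
    res (T.obj N) h (tensorOne adj N W n) = tensorOne adj N V (res N h n) :=
  res_sapp (adj.unit.app N) h n

@[simp]
lemma sapp_map_tensorOne (f : M ⟶ N) (n : Sec M W) :
    sapp (T.map f) W (tensorOne adj M W n) = tensorOne adj N W (sapp f W n) :=
  (congrArg (fun g => sapp g W n) (adj.unit.naturality f)).symm

@[simp]
lemma sapp_counit_tensorOne (p : Sec P W) :
    sapp (adj.counit.app P) W
      (tensorOne adj ((SheafOfModules.restrictScalars.{u} φ).obj P) W p) = p :=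
  congrArg (fun g : (SheafOfModules.restrictScalars.{u} φ).obj P ⟶
    (SheafOfModules.restrictScalars.{u} φ).obj P => sapp g W p) (adj.right_triangle_components P)

include adj in
lemma hom_ext_tensorOne {f g : T.obj N ⟶ P}
    (h : ∀ W n, sapp f W (tensorOne adj N W n) = sapp g W (tensorOne adj N W n)) : f = g := by
  apply (adj.homEquiv N P).injective
  rw [adj.homEquiv_unit, adj.homEquiv_unit]
  exact hom_ext_sapp h

lemma exists_desc_tensorOne (g : N ⟶ (SheafOfModules.restrictScalars.{u} φ).obj P) :
    ∃ f : T.obj N ⟶ P, ∀ W n, sapp f W (tensorOne adj N W n) = sapp g W n := by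
  refine ⟨(adj.homEquiv N P).symm g, fun W n => ?_⟩
  have h : adj.unit.app N ≫ (SheafOfModules.restrictScalars.{u} φ).map
      ((adj.homEquiv N P).symm g) = g :=
    (adj.homEquiv_unit N P _).symm.trans (Equiv.apply_symm_apply _ _)
  exact congrArg (fun k => sapp k W n) h

/-- A family of sections of `S` over `U` which is a basis of `S` as a right `R`-module
over every open subset of `U`. -/
structure Frame (φ : R ⟶ S) (U : Opens X) where
  /-- the number of elements of the basis -/
  rank : ℕ
  /-- the elements of the basis -/
  b : Fin rank → RSec S U
  bijective {W : Opens X} (h : W ≤ U) : Function.Bijective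
    fun c : Fin rank → RSec R W => ∑ i, rres S h (b i) * rapp φ W (c i)

namespace Frame

variable (F : Frame φ U)

/-- The sum of a family of coordinates against the basis. -/
def lin (h : W ≤ U) : (Fin F.rank → RSec R W) →+ RSec S W where
  toFun c := ∑ i, rres S h (F.b i) * rapp φ W (c i)
  map_zero' := by simp
  map_add' c c' := by simp [mul_add, Finset.sum_add_distrib]

/-- The coordinates of a section of `S`. -/
def coord (h : W ≤ U) : RSec S W ≃+ (Fin F.rank → RSec R W) :=
  (AddEquiv.ofBijective (F.lin h) (F.bijective h)).symm

lemma sum_coord (h : W ≤ U) (s : RSec S W) :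
    ∑ i, rres S h (F.b i) * rapp φ W (F.coord h s i) = s :=
  (AddEquiv.ofBijective (F.lin h) (F.bijective h)).apply_symm_apply s

lemma coord_eq (h : W ≤ U) {s : RSec S W} {c : Fin F.rank → RSec R W}
    (hc : ∑ i, rres S h (F.b i) * rapp φ W (c i) = s) : F.coord h s = c := by
  apply (F.bijective h).1
  exact (F.sum_coord h s).trans hc.symm

lemma coord_b (h : W ≤ U) (j : Fin F.rank) : F.coord h (rres S h (F.b j)) = Pi.single j 1 := by
  classical
  refine F.coord_eq h ?_
  rw [Finset.sum_eq_single j]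
  · simp
  · intro i _ hij
    simp [Pi.single_eq_of_ne hij]
  · simp

lemma coord_mul_rapp (h : W ≤ U) (s : RSec S W) (r : RSec R W) (i : Fin F.rank) :
    F.coord h (s * rapp φ W r) i = F.coord h s i * r := by
  refine congrFun (F.coord_eq h (c := fun i => F.coord h s i * r) ?_) i
  conv_rhs => rw [← F.sum_coord h s, Finset.sum_mul]
  simp [mul_assoc]

lemma rres_coord (h : W ≤ U) (h' : V ≤ W) (s : RSec S W) (i : Fin F.rank) :
    rres R h' (F.coord h s i) = F.coord (h'.trans h) (rres S h' s) i := by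
  refine (congrFun (F.coord_eq (h'.trans h) (c := fun i => rres R h' (F.coord h s i)) ?_) i).symm
  conv_rhs => rw [← F.sum_coord h s, map_sum]
  simp

/-- The matrix of left multiplication by a section of `S`. -/
def mat (h : W ≤ U) : RSec S W →+* Matrix (Fin F.rank) (Fin F.rank) (RSec R W) where
  toFun s := Matrix.of fun i j => F.coord h (s * rres S h (F.b j)) i
  map_one' := by
    ext i j
    rw [Matrix.of_apply, one_mul, F.coord_b, Matrix.one_apply, Pi.single_apply]
  map_zero' := by ext i j; simp
  map_add' s s' := by ext i j; simp [add_mul]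
  map_mul' s s' := by
    ext i j
    rw [Matrix.mul_apply, Matrix.of_apply, mul_assoc,
      ← F.sum_coord h (s' * rres S h (F.b j)), Finset.mul_sum, map_sum, Finset.sum_apply]
    refine Finset.sum_congr rfl fun k _ => ?_
    rw [← mul_assoc, F.coord_mul_rapp]
    rfl

lemma mat_apply (h : W ≤ U) (s : RSec S W) (i j : Fin F.rank) :
    F.mat h s i j = F.coord h (s * rres S h (F.b j)) i := rfl

lemma sum_mat_mul_coord (h : W ≤ U) (s t : RSec S W) (i : Fin F.rank) :
    ∑ j, F.mat h s i j * F.coord h t j = F.coord h (s * t) i := by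
  conv_rhs => rw [← F.sum_coord h t, Finset.mul_sum, map_sum, Finset.sum_apply]
  exact Finset.sum_congr rfl fun k _ => by rw [← mul_assoc, F.coord_mul_rapp]; rfl

lemma rres_mat (h : W ≤ U) (h' : V ≤ W) (s : RSec S W) (i j : Fin F.rank) :
    rres R h' (F.mat h s i j) = F.mat (h'.trans h) (rres S h' s) i j := by
  rw [mat_apply, mat_apply, rres_coord, map_mul, rres_rres]

open scoped Matrix.Module in
/-- The action of sections of `S` on families of sections of `N` through matrices. -/
@[reducible]
def module (N : SheafOfModules.{u} R) (W : Opens X) :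
    Module (RSec S W) (Fin F.rank → Sec N (W ⊓ U)) :=
  Module.compHom _ ((F.mat (inf_le_right : W ⊓ U ≤ U)).comp (rres S inf_le_left))

/-- The presheaf `W ↦ N(W ∩ U)ʳ`. -/
def presheaf (N : SheafOfModules.{u} R) : (Opens X)ᵒᵖ ⥤ Ab.{u} where
  obj W := AddCommGrpCat.of (Fin F.rank → Sec N (W.unop ⊓ U))
  map f := AddCommGrpCat.ofHom
    { toFun n i := res N (inf_le_inf_right U (leOfHom f.unop)) (n i)
      map_zero' := by ext i; simp
      map_add' n n' := by ext i; simp }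
  map_id W := by ext n i; exact res_self _
  map_comp f g := by ext n i; exact (res_res _ _ _).symm

instance (N : SheafOfModules.{u} R) (W : (Opens X)ᵒᵖ) :
    Module (S.obj.obj W) ((F.presheaf N).obj W) := F.module N W.unop

/-- The extension of scalars of `N` over `U`, extended to `X` as a direct image: the sheaf
of `S`-modules `W ↦ N(W ∩ U)ʳ`, where `r` is the rank of the frame. -/
def localModel (N : SheafOfModules.{u} R) : SheafOfModules.{u} S :=
  ofSec (F.presheaf N)
    (fun W W' f s n => by
      funext i
      change res N _ (∑ j, F.mat (inf_le_right : W.unop ⊓ U ≤ U) (rres S inf_le_left s) i j •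
          (show Fin F.rank → Sec N (W.unop ⊓ U) from n) j) =
        ∑ j, F.mat (inf_le_right : W'.unop ⊓ U ≤ U)
          (rres S inf_le_left (rres S (leOfHom f.unop) s)) i j •
            res N _ ((show Fin F.rank → Sec N (W.unop ⊓ U) from n) j)
      simp only [map_sum, res_smul, rres_mat, rres_rres])
    (fun ι V sf hsf => by
      have key (i : Fin F.rank) : ∃ t : Sec N (iSup V ⊓ U), ∀ k,
          res N (inf_le_inf_right U (le_iSup V k)) t =
            (show Fin F.rank → Sec N (V k ⊓ U) from sf k) i := by
        refine exists_glue (fun k => V k ⊓ U) _ (by rw [iSup_inf_eq]) _ fun k l => ?_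
        have := congrArg (res N (le_inf (inf_le_inf inf_le_left inf_le_left)
          (inf_le_left.trans inf_le_right) : (V k ⊓ U) ⊓ (V l ⊓ U) ≤ (V k ⊓ V l) ⊓ U))
          (congrFun (hsf k l : (_ : Fin F.rank → Sec N ((V k ⊓ V l) ⊓ U)) = _) i)
        exact ((res_res _ _ _).symm.trans this).trans (res_res _ _ _)
      choose t ht using key
      refine ⟨t, fun k => funext fun i => ht i k, fun t' ht' => funext fun i => ?_⟩
      refine sec_ext fun x hx => ?_
      obtain ⟨k, hk⟩ := Opens.mem_iSup.1 hx.1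
      exact ⟨V k ⊓ U, inf_le_inf_right U (le_iSup V k), ⟨hk, hx.2⟩,
        (congrFun (ht' k : (_ : Fin F.rank → Sec N (V k ⊓ U)) = _) i).trans (ht i k).symm⟩)

section TensorSum

variable (F : Frame φ U)

/-- The sum `∑ bᵢ ⊗ nᵢ` as a section of the extension of scalars of `N`. -/
def tensorSum (N : SheafOfModules.{u} R) (h : W ≤ U) :
    (Fin F.rank → Sec N W) →+ Sec (T.obj N) W where
  toFun n := ∑ i, rres S h (F.b i) • tensorOne adj N W (n i)
  map_zero' := by simp
  map_add' n n' := by simp [smul_add, Finset.sum_add_distrib]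

lemma tensorSum_apply (h : W ≤ U) (n : Fin F.rank → Sec N W) :
    F.tensorSum adj N h n = ∑ i, rres S h (F.b i) • tensorOne adj N W (n i) := rfl

lemma res_tensorSum (h : W ≤ U) (h' : V ≤ W) (n : Fin F.rank → Sec N W) :
    res (T.obj N) h' (F.tensorSum adj N h n) =
      F.tensorSum adj N (h'.trans h) fun i => res N h' (n i) := by
  simp [tensorSum_apply]

lemma smul_tensorSum (h : W ≤ U) (s : RSec S W) (n : Fin F.rank → Sec N W) :
    s • F.tensorSum adj N h n = F.tensorSum adj N h fun i => ∑ j, F.mat h s i j • n j := by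
  simp only [tensorSum_apply, Finset.smul_sum, map_sum, tensorOne_smul, smul_smul]
  rw [Finset.sum_comm]
  refine Finset.sum_congr rfl fun j _ => ?_
  rw [← F.sum_coord h (s * rres S h (F.b j)), Finset.sum_smul]
  rfl

lemma tensorOne_eq_tensorSum (h : W ≤ U) (n : Sec N W) :
    tensorOne adj N W n = F.tensorSum adj N h fun i => F.coord h 1 i • n := by
  simp only [tensorSum_apply, tensorOne_smul, smul_smul, ← Finset.sum_smul]
  rw [F.sum_coord, one_smul]

lemma sapp_map_tensorSum (h : W ≤ U) (f : M ⟶ N) (m : Fin F.rank → Sec M W) :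
    sapp (T.map f) W (F.tensorSum adj M h m) = F.tensorSum adj N h fun i => sapp f W (m i) := by
  simp [tensorSum_apply]

/-- The map `n ↦ 1 ⊗ n` into the local model. -/
def toLocalModel (N : SheafOfModules.{u} R) :
    N ⟶ (SheafOfModules.restrictScalars.{u} φ).obj (F.localModel N) :=
  homMkSec (N := (SheafOfModules.restrictScalars.{u} φ).obj (F.localModel N))
    (fun W n => (fun i => F.coord (inf_le_right : W ⊓ U ≤ U) 1 i • res N inf_le_left n :
      Fin F.rank → Sec N (W ⊓ U)))
    (fun W n n' => by
      funext i
      change F.coord (inf_le_right : W ⊓ U ≤ U) 1 i • res N (inf_le_left : W ⊓ U ≤ W) (n + n') =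
        F.coord (inf_le_right : W ⊓ U ≤ U) 1 i • res N (inf_le_left : W ⊓ U ≤ W) n +
          F.coord (inf_le_right : W ⊓ U ≤ U) 1 i • res N (inf_le_left : W ⊓ U ≤ W) n'
      rw [map_add, smul_add])
    (fun W r n => by
      funext i
      change F.coord (inf_le_right : W ⊓ U ≤ U) 1 i • res N (inf_le_left : W ⊓ U ≤ W) (r • n) =
        ∑ j, F.mat (inf_le_right : W ⊓ U ≤ U) (rres S inf_le_left (rapp φ W r)) i j •
          F.coord (inf_le_right : W ⊓ U ≤ U) 1 j • res N (inf_le_left : W ⊓ U ≤ W) n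
      simp only [smul_smul, ← Finset.sum_smul]
      rw [F.sum_mat_mul_coord, rres_rapp, mul_one, ← one_mul (rapp φ _ _), F.coord_mul_rapp,
        res_smul, smul_smul])
    (fun {W W'} h n => by
      funext i
      change res N (inf_le_inf_right U h)
          (F.coord (inf_le_right : W ⊓ U ≤ U) 1 i • res N (inf_le_left : W ⊓ U ≤ W) n) =
        F.coord (inf_le_right : W' ⊓ U ≤ U) 1 i •
          res N (inf_le_left : W' ⊓ U ≤ W') (res N h n)
      rw [res_smul, rres_coord, map_one, res_res, res_res])

include adj in
/-- The coordinates `nᵢ` of `∑ bᵢ ⊗ nᵢ` are recovered from its image in the local model. -/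
lemma tensorSum_injective (h : W ≤ U) : Function.Injective (F.tensorSum adj N h) := by
  obtain ⟨f, hf⟩ := exists_desc_tensorOne adj (F.toLocalModel N)
  have key (n : Fin F.rank → Sec N W) (i : Fin F.rank) :
      (show Fin F.rank → Sec N (W ⊓ U) from sapp f W (F.tensorSum adj N h n)) i =
        res N inf_le_left (n i) := by
    have e : sapp f W (F.tensorSum adj N h n) =
        ∑ j, rres S h (F.b j) • (show Sec (F.localModel N) W from sapp (F.toLocalModel N) W (n j)) := by
      rw [tensorSum_apply, map_sum]
      exact Finset.sum_congr rfl fun j _ => (map_smul _ _ _).trans (congrArg _ (hf W (n j)))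
    rw [e]
    refine (Finset.sum_apply (M := fun _ => Sec N (W ⊓ U)) i Finset.univ _).trans ?_
    have e' (j : Fin F.rank) : (show Fin F.rank → Sec N (W ⊓ U) from
        rres S h (F.b j) • (show Sec (F.localModel N) W from sapp (F.toLocalModel N) W (n j))) i =
          (Pi.single j 1 : Fin F.rank → RSec R (W ⊓ U)) i • res N inf_le_left (n j) := by
      change ∑ k, F.mat (inf_le_right : W ⊓ U ≤ U) (rres S inf_le_left (rres S h (F.b j))) i k •
          F.coord (inf_le_right : W ⊓ U ≤ U) 1 k • res N inf_le_left (n j) = _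
      simp only [smul_smul, ← Finset.sum_smul]
      rw [F.sum_mat_mul_coord, mul_one, rres_rres, F.coord_b]
    rw [Finset.sum_congr rfl fun j _ => e' j, Finset.sum_eq_single i]
    · simp
    · intro j _ hj
      rw [Pi.single_eq_of_ne hj.symm, zero_smul]
    · simp
  intro n n' hn
  funext i
  refine sec_ext fun x hx => ⟨W ⊓ U, inf_le_left, ⟨hx, h hx⟩, ?_⟩
  rw [← key, ← key, hn]

/-- The sections of the extension of scalars which, near each point of `U`, are sums
`∑ bᵢ ⊗ nᵢ`. -/
def tensorSumSubsheaf (N : SheafOfModules.{u} R) : Subsheaf (T.obj N) where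
  carrier W :=
    { carrier := {t | ∀ x ∈ W, x ∈ U → ∃ (V : Opens X) (h : V ≤ W) (h' : V ≤ U), x ∈ V ∧
        ∃ n, F.tensorSum adj N h' n = res (T.obj N) h t}
      zero_mem' := fun x hx hxU => ⟨W ⊓ U, inf_le_left, inf_le_right, ⟨hx, hxU⟩, 0, by simp⟩
      add_mem' := fun {t t'} ht ht' x hx hxU => by
        obtain ⟨V, h, h', hxV, m, hm⟩ := ht x hx hxU
        obtain ⟨V', k, k', hxV', m', hm'⟩ := ht' x hx hxU
        refine ⟨V ⊓ V', inf_le_left.trans h, inf_le_left.trans h', ⟨hxV, hxV'⟩,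
          (fun i => res N inf_le_left (m i)) + (fun i => res N inf_le_right (m' i)), ?_⟩
        rw [map_add, map_add, ← res_tensorSum adj F h' inf_le_left m,
          ← res_tensorSum adj F k' inf_le_right m', hm, hm', res_res, res_res]
      smul_mem' := fun s t ht x hx hxU => by
        obtain ⟨V, h, h', hxV, m, hm⟩ := ht x hx hxU
        exact ⟨V, h, h', hxV, _, by rw [res_smul, ← hm, smul_tensorSum]⟩ }
  res_mem {V W} h t ht x hx hxU := by
    obtain ⟨V', k, k', hxV, m, hm⟩ := ht x (h hx) hxU
    exact ⟨V' ⊓ W, inf_le_right, inf_le_left.trans k', ⟨hxV, hx⟩, _, by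
      rw [← res_tensorSum adj F k' inf_le_left m, hm, res_res, res_res]⟩
  local_mem {W t} ht x hx hxU := by
    obtain ⟨V, h, hxV, ht'⟩ := ht x hx
    obtain ⟨V', k, k', hxV', m, hm⟩ := ht' x hxV hxU
    exact ⟨V', k.trans h, k', hxV', m, by rw [hm, res_res]⟩

/-- The subsheaf of local sums `∑ bᵢ ⊗ nᵢ` contains the image of `N`, hence is everything by the
universal property; the local expressions glue as they are unique. -/
lemma tensorSum_surjective (h : W ≤ U) : Function.Surjective (F.tensorSum adj N h) := by
  let D := F.tensorSumSubsheaf adj N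
  have hD (V : Opens X) (n : Sec N V) : tensorOne adj N V n ∈ D.carrier V := fun x hx hxU =>
    ⟨V ⊓ U, inf_le_left, inf_le_right, ⟨hx, hxU⟩, _, by
      rw [res_tensorOne, F.tensorOne_eq_tensorSum adj inf_le_right]⟩
  -- the map `N ⟶ π D` induced by `n ↦ 1 ⊗ n`, and its extension `T N ⟶ D`
  obtain ⟨g, hg⟩ := exists_desc_tensorOne adj (N := N) (P := D.toSheafOfModules)
    (homMkSec (N := (SheafOfModules.restrictScalars.{u} φ).obj D.toSheafOfModules)
      (fun V n => (⟨tensorOne adj N V n, hD V n⟩ : D.carrier V))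
      (fun V n n' => Subtype.ext (map_add (tensorOne adj N V) n n'))
      (fun V r n => Subtype.ext (tensorOne_smul adj r n))
      (fun h n => Subtype.ext (res_tensorOne adj h n)))
  have hgι : g ≫ D.ι = 𝟙 _ := hom_ext_tensorOne adj fun V n => by
    rw [sapp_comp, hg]
    rfl
  intro t
  have ht := D.sapp_ι_mem W (sapp g W t)
  rw [← sapp_comp, hgι, sapp_id] at ht
  have key (x : W) := ht x.1 x.2 (h x.2)
  choose V hV hVU hxV n hn using key
  have glue (i : Fin F.rank) : ∃ m : Sec N W, ∀ x, res N (hV x) m = n x i := by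
    refine exists_glue V hV (fun x hx => Opens.mem_iSup.2 ⟨⟨x, hx⟩, hxV _⟩) (fun x => n x i)
      fun x y => ?_
    refine congrFun (F.tensorSum_injective adj (inf_le_left.trans (hVU x)) ?_ :
      (fun i => res N inf_le_left (n x i)) = fun i => res N inf_le_right (n y i)) i
    rw [← res_tensorSum adj F (hVU x) inf_le_left, ← res_tensorSum adj F (hVU y) inf_le_right,
      hn, hn, res_res, res_res]
  choose m hm using glue
  refine ⟨m, sec_ext fun x hx => ⟨V ⟨x, hx⟩, hV _, hxV _, ?_⟩⟩
  rw [res_tensorSum, ← hn]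
  congr 1
  funext i
  exact hm i _

end TensorSum

end Frame

end ExtensionOfScalars

/-! ### Exactness of extension and restriction of scalars -/

section Exactness

variable {X : TopCat.{u}} {R S : Sheaf (Opens.grothendieckTopology X) RingCat.{u}} {φ : R ⟶ S}
  {T : SheafOfModules.{u} R ⥤ SheafOfModules.{u} S}
  (adj : T ⊣ SheafOfModules.restrictScalars.{u} φ)
  {M N : SheafOfModules.{u} R} {P : SheafOfModules.{u} S} {U V W : Opens X}

instance faithful_restrictScalars : (SheafOfModules.restrictScalars.{u} φ).Faithful where
  map_injective {P Q} _ _ h := hom_ext_sapp fun U m =>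
    congrArg (fun k : (SheafOfModules.restrictScalars.{u} φ).obj P ⟶
      (SheafOfModules.restrictScalars.{u} φ).obj Q => sapp k U m) h

instance : (SheafOfModules.restrictScalars.{u} φ).PreservesEpimorphisms where
  preserves {_ Q} f _ := epi_of_local_preimage _ fun _ n _ hx =>
    exists_local_preimage_of_epi f (show Sec Q _ from n) hx

include adj in
/-- Locally, extension of scalars is `N ↦ Nʳ`. -/
lemma preservesMonomorphisms_of_frames (hφ : ∀ x : X, ∃ U : Opens X, x ∈ U ∧ Nonempty (Frame φ U)) :
    T.PreservesMonomorphisms where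
  preserves {M N} f _ := mono_of_injective_sapp _ fun W => by
    rw [injective_iff_map_eq_zero]
    intro t ht
    refine sec_ext fun x hx => ?_
    obtain ⟨U, hxU, ⟨F⟩⟩ := hφ x
    refine ⟨W ⊓ U, inf_le_left, ⟨hx, hxU⟩, ?_⟩
    obtain ⟨m, hm⟩ := F.tensorSum_surjective adj (inf_le_right : W ⊓ U ≤ U)
      (res _ inf_le_left t)
    have hm0 : F.tensorSum adj N inf_le_right (fun i => sapp f (W ⊓ U) (m i)) = 0 := by
      rw [← F.sapp_map_tensorSum, hm, ← res_sapp, ht, map_zero]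
    have h0 := F.tensorSum_injective adj inf_le_right (hm0.trans (map_zero _).symm)
    have : m = 0 := funext fun i => injective_sapp_of_mono f _
      ((congrFun h0 i).trans (map_zero _).symm)
    rw [← hm, this, map_zero, map_zero]

include adj in
lemma preservesFiniteLimits_of_frames
    (hφ : ∀ x : X, ∃ U : Opens X, x ∈ U ∧ Nonempty (Frame φ U)) :
    PreservesFiniteLimits T := by
  have := preservesMonomorphisms_of_frames adj hφ
  have : T.Additive := adj.left_adjoint_additive
  have : PreservesColimits T := adj.leftAdjoint_preservesColimits
  have : T.PreservesHomology := Functor.preservesHomology_of_preservesMonos_and_cokernels T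
  exact T.preservesFiniteLimits_of_preservesHomology

include adj in
/-- Epimorphisms of sheaves of modules are the locally surjective morphisms, whatever the ring. -/
lemma preservesFiniteColimits_restrictScalars :
    PreservesFiniteColimits (SheafOfModules.restrictScalars.{u} φ) := by
  have : PreservesLimits (SheafOfModules.restrictScalars.{u} φ) := adj.rightAdjoint_preservesLimits
  have : (SheafOfModules.restrictScalars.{u} φ).PreservesHomology :=
    Functor.preservesHomology_of_preservesEpis_and_kernels _
  exact Functor.preservesFiniteColimits_of_preservesHomology _

end Exactness

/-! ### Quasi-coherence in terms of sections -/

section Quasicoherent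

variable {X : Scheme.{u}}

/-- The sections of `M` over a basic open subset `D(f)` of `U` are the fractions, with powers of
`f` as denominators, of sections over `U`. -/
def IsLocalizingOn (M : SheafOfModules.{u} X.ringCatSheaf) (U : X.Opens) : Prop :=
  ∀ f : RSec X.ringCatSheaf U,
    (∀ s : Sec M (X.basicOpen f), ∃ (n : ℕ) (t : Sec M U),
      res M (X.basicOpen_le f) t = rres X.ringCatSheaf (X.basicOpen_le f) (f ^ n) • s) ∧
    ∀ t : Sec M U, res M (X.basicOpen_le f) t = 0 → ∃ n : ℕ, f ^ n • t = 0

lemma isLocalizing_modulesSpecToSheaf_iff {R : CommRingCat.{u}} (N : (Spec R).Modules) :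
    IsLocalizing (modulesSpecToSheaf.obj N) ↔
      ∀ (f : R) (D : (Spec R).Opens), PrimeSpectrum.basicOpen f = D →
        (∀ s : Γ(N, D), ∃ (n : ℕ) (t : Γ(N, ⊤)), N.presheaf.map D.leTop.op t = f ^ n • s) ∧
        ∀ t : Γ(N, ⊤), N.presheaf.map D.leTop.op t = 0 → ∃ n : ℕ, f ^ n • t = 0 := by
  refine forall_congr' fun f => ⟨fun h D hD => ?_, fun h => ?_⟩
  · subst hD
    have : IsLocalizedModule.Away f
      ((modulesSpecToSheaf.obj N).obj.map (PrimeSpectrum.basicOpen f).leTop.op).hom := h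
    refine ⟨fun s => ?_, fun t ht => ?_⟩
    · obtain ⟨n, t, ht⟩ := this.surj _ _ s
      exact ⟨n, t, ht.symm⟩
    · obtain ⟨⟨_, n, rfl⟩, hn⟩ := (IsLocalizedModule.eq_zero_iff (.powers f)
        ((modulesSpecToSheaf.obj N).obj.map (PrimeSpectrum.basicOpen f).leTop.op).hom).mp ht
      exact ⟨n, hn⟩
  · refine IsLocalizedModule.Away.mk_of_addCommGroup
      (Scheme.Modules.isUnit_algebraMap_end_of_le_basicOpen f le_rfl) (fun s => ?_) (h _ rfl).2
    obtain ⟨n, t, ht⟩ := (h _ rfl).1 s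
    exact ⟨n, t, ht.symm⟩

lemma image_fromSpec_le {U : X.Opens} (hU : IsAffineOpen U) (W : (Spec Γ(X, U)).Opens) :
    hU.fromSpec ''ᵁ W ≤ U :=
  ((hU.fromSpec.image_mono le_top).trans hU.fromSpec.image_top_eq_opensRange.le).trans
    hU.opensRange_fromSpec.le

/-- The sections of a module over an affine open `U`, seen as a module over `Spec Γ(X, U)`. -/
def restrictEquiv {U : X.Opens} (hU : IsAffineOpen U) (M : SheafOfModules.{u} X.ringCatSheaf)
    (W : (Spec Γ(X, U)).Opens) {W' : X.Opens} (h : hU.fromSpec ''ᵁ W = W') :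
    Γ(Scheme.Modules.restrict (Y := X) M hU.fromSpec, W) ≃+ Sec M W' where
  toFun := res M h.ge
  invFun := res M h.le
  left_inv _ := (res_res _ _ _).trans (res_self _)
  right_inv _ := (res_res _ _ _).trans (res_self _)
  map_add' := map_add (res M h.ge)

lemma restrictEquiv_map {U : X.Opens} (hU : IsAffineOpen U)
    (M : SheafOfModules.{u} X.ringCatSheaf) {W V : (Spec Γ(X, U)).Opens} (i : V ⟶ W)
    {W' V' : X.Opens} (hW : hU.fromSpec ''ᵁ W = W') (hV : hU.fromSpec ''ᵁ V = V') (h : V' ≤ W')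
    (x : Γ(Scheme.Modules.restrict (Y := X) M hU.fromSpec, W)) :
    restrictEquiv hU M V hV ((Scheme.Modules.restrict (Y := X) M hU.fromSpec).presheaf.map i.op x) =
      res M h (restrictEquiv hU M W hW x) := by
  let y : Sec M (hU.fromSpec ''ᵁ W) := x
  change res M hV.ge (res M (hU.fromSpec.image_mono (leOfHom i)) y) = res M h (res M hW.ge y)
  rw [res_res, res_res]

lemma restrictEquiv_smul {U : X.Opens} (hU : IsAffineOpen U)
    (M : SheafOfModules.{u} X.ringCatSheaf) (W : (Spec Γ(X, U)).Opens) {W' : X.Opens}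
    (h : hU.fromSpec ''ᵁ W = W') (h' : W' ≤ U) (r : Γ(X, U))
    (x : Γ(Scheme.Modules.restrict (Y := X) M hU.fromSpec, W)) :
    restrictEquiv hU M W h (r • x) =
      rres X.ringCatSheaf h' r • restrictEquiv hU M W h x := by
  have e : W ≤ hU.fromSpec ⁻¹ᵁ U := by rw [hU.fromSpec_preimage_self]; exact le_top
  have h1 : (Scheme.ΓSpecIso Γ(X, U)).inv ≫ (Spec Γ(X, U)).presheaf.map W.leTop.op =
      hU.fromSpec.appLE U W e := by
    rw [Scheme.Hom.appLE, hU.fromSpec_app_self, Category.assoc, ← Functor.map_comp]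
    rfl
  have h2 := hU.fromSpec.appLE_appIso_inv e
  rw [← h1] at h2
  have h3 := ConcreteCategory.congr_hom h2 r
  let y : Sec M (hU.fromSpec ''ᵁ W) := x
  have h4 : restrictEquiv hU M W h (r • x) =
      res M h.ge (rres X.ringCatSheaf (image_fromSpec_le hU W) r • y) :=
    congrArg (fun t : RSec X.ringCatSheaf (hU.fromSpec ''ᵁ W) => res M h.ge (t • y)) h3
  rw [h4]
  refine (res_smul _ _ _).trans ?_
  exact congrArg (fun t => t • restrictEquiv hU M W h x) (rres_rres _ _ _)

lemma restrictEquiv_smul_top {U : X.Opens} (hU : IsAffineOpen U)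
    (M : SheafOfModules.{u} X.ringCatSheaf) (h : hU.fromSpec ''ᵁ ⊤ = U) (r : Γ(X, U))
    (x : Γ(Scheme.Modules.restrict (Y := X) M hU.fromSpec, ⊤)) :
    restrictEquiv hU M ⊤ h (r • x) =
      (show RSec X.ringCatSheaf U from r) • restrictEquiv hU M ⊤ h x :=
  (restrictEquiv_smul hU M ⊤ h le_rfl r x).trans
    (congrArg (fun t => t • restrictEquiv hU M ⊤ h x) (rres_self _))

/-- The condition on basic open subsets, transported to `Spec Γ(X, U)`, says that the restriction
of `M` is the sheaf associated with its module of global sections. -/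
lemma isLocalizingOn_iff {U : X.Opens} (hU : IsAffineOpen U)
    (M : SheafOfModules.{u} X.ringCatSheaf) :
    IsLocalizingOn M U ↔
      IsIso (Scheme.Modules.fromTildeΓ (Scheme.Modules.restrict (Y := X) M hU.fromSpec)) := by
  rw [isIso_fromTildeΓ_iff_isLocalizing, isLocalizing_modulesSpecToSheaf_iff]
  have h1 : hU.fromSpec ''ᵁ ⊤ = U := by
    rw [Scheme.Hom.image_top_eq_opensRange, hU.opensRange_fromSpec]
  have key (f : Γ(X, U)) (D : (Spec Γ(X, U)).Opens) (hD : PrimeSpectrum.basicOpen f = D) :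
      hU.fromSpec ''ᵁ D = X.basicOpen f := by
    rw [← hD]
    exact hU.fromSpec_image_basicOpen f
  refine forall_congr' fun (f : Γ(X, U)) => ⟨fun h D hD => ?_, fun h => ?_⟩
  · refine ⟨fun s => ?_, fun t ht => ?_⟩
    · obtain ⟨n, t, ht⟩ := h.1 (restrictEquiv hU M D (key f D hD) s)
      refine ⟨n, (restrictEquiv hU M _ h1).symm t, ?_⟩
      apply (restrictEquiv hU M D (key f D hD)).injective
      rw [restrictEquiv_smul hU M D (key f D hD) (X.basicOpen_le f),
        restrictEquiv_map hU M _ h1 (key f D hD) (X.basicOpen_le f)]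
      exact (congrArg (res M _) ((restrictEquiv hU M _ h1).apply_symm_apply t)).trans ht
    · obtain ⟨n, hn⟩ := h.2 (restrictEquiv hU M _ h1 t) (by
        rw [← restrictEquiv_map hU M D.leTop h1 (key f D hD), ht, map_zero])
      refine ⟨n, (restrictEquiv hU M _ h1).injective ?_⟩
      rw [restrictEquiv_smul_top, map_zero]
      exact hn
  · obtain ⟨hs, ht⟩ := h _ rfl
    let D : (Spec Γ(X, U)).Opens := PrimeSpectrum.basicOpen f
    refine ⟨fun s => ?_, fun t h0 => ?_⟩
    · obtain ⟨n, t, h2⟩ := hs ((restrictEquiv hU M D (key f D rfl)).symm s)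
      refine ⟨n, restrictEquiv hU M _ h1 t, ?_⟩
      rw [← restrictEquiv_map hU M D.leTop h1 (key f D rfl)]
      refine (congrArg _ h2).trans ?_
      refine (restrictEquiv_smul hU M D (key f D rfl) (X.basicOpen_le f) _ _).trans ?_
      rw [AddEquiv.apply_symm_apply]
      rfl
    · obtain ⟨n, h2⟩ := ht ((restrictEquiv hU M _ h1).symm t) (by
        apply (restrictEquiv hU M D (key f D rfl)).injective
        refine (restrictEquiv_map hU M D.leTop h1 (key f D rfl) (X.basicOpen_le f) _).trans ?_
        rw [AddEquiv.apply_symm_apply, h0, map_zero])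
      refine ⟨n, ?_⟩
      have h3 := congrArg (restrictEquiv hU M _ h1) h2
      rw [restrictEquiv_smul_top, map_zero, AddEquiv.apply_symm_apply] at h3
      exact h3

lemma IsLocalizingOn.of_isQuasicoherent (M : SheafOfModules.{u} X.ringCatSheaf)
    [SheafOfModules.IsQuasicoherent.{u} M] {U : X.Opens} (hU : IsAffineOpen U) :
    IsLocalizingOn M U := by
  rw [isLocalizingOn_iff hU]
  have : SheafOfModules.IsQuasicoherent.{u} (Scheme.Modules.restrict (Y := X) M hU.fromSpec) :=
    Scheme.Modules.isQuasicoherent_restrictFunctor (Y := X) hU.fromSpec M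
  infer_instance

/-- A presentation of the restriction of a module to an open subset, as a module on
the slice site, from a presentation as a module over the open subscheme. -/
def presentationOver (M : SheafOfModules.{u} X.ringCatSheaf) (U : X.Opens)
    (P : (Scheme.Modules.restrict (Y := X) M U.ι).Presentation) : (M.over U).Presentation :=
  let e : SheafOfModules.{u} (X.ringCatSheaf.over U) ≌
    SheafOfModules.{u} (U : Scheme.{u}).ringCatSheaf := Scheme.Modules.overEquiv U
  have : PreservesColimitsOfSize.{u, u} e.inverse :=
    e.symm.toAdjunction.leftAdjoint_preservesColimits
  let i (N : X.Modules) : N.over U ≅ e.inverse.obj (N.restrict U.ι) :=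
    e.unitIso.app (N.over U) ≪≫ e.inverse.mapIso ((Scheme.Modules.overFunctorEquiv U).app N)
  .ofIsIso (i M).inv (P.map e.inverse
    (i (SheafOfModules.unit X.ringCatSheaf) ≪≫
      e.inverse.mapIso (Scheme.Modules.restrictUnitIso U.ι)))

/-- Locally on `X`, the module is associated with a module of sections, which has a presentation. -/
lemma isQuasicoherent_of_isLocalizingOn {M : SheafOfModules.{u} X.ringCatSheaf}
    (hM : ∀ x : X, ∃ U : X.Opens, x ∈ U ∧ IsAffineOpen U ∧ IsLocalizingOn M U) :
    SheafOfModules.IsQuasicoherent.{u} M := by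
  choose U hxU hU hMU using hM
  have P (x : X) : Nonempty (M.over (U x)).Presentation := by
    let N : (Spec Γ(X, U x)).Modules := Scheme.Modules.restrict (Y := X) M (hU x).fromSpec
    have : IsIso (C := SheafOfModules.{u} (Spec Γ(X, U x)).ringCatSheaf) N.fromTildeΓ :=
      (isLocalizingOn_iff (hU x) M).1 (hMU x)
    have P : N.Presentation := SheafOfModules.Presentation.ofIsIso.{u, u, u} N.fromTildeΓ
      (presentationTilde.{u} _ .univ (by simp) _ (Submodule.span_eq _))
    let i : N.restrict (hU x).isoSpec.hom ≅ Scheme.Modules.restrict (Y := X) M (U x).ι :=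
      (Scheme.Modules.restrictFunctorComp (hU x).isoSpec.hom (hU x).fromSpec).symm.app M ≪≫
        (Scheme.Modules.restrictFunctorCongr (hU x).isoSpec_hom_fromSpec).app M
    have : IsIso (C := SheafOfModules.{u} (U x : Scheme.{u}).ringCatSheaf) i.hom :=
      i.isIso_hom
    exact ⟨presentationOver M (U x)
      (SheafOfModules.Presentation.ofIsIso.{u, u, u} i.hom
        (Scheme.Modules.presentationRestrict (hU x).isoSpec.hom P))⟩
  let q : SheafOfModules.QuasicoherentData.{u, u, u, u} M :=
    { I := X
      X := U
      coversTop := (Opens.coversTop_iff _ _).2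
        (IsOpenCover.mk (eq_top_iff.2 fun x _ => Opens.mem_iSup.2 ⟨x, hxU x⟩))
      presentation x := (P x).some }
  exact q.isQuasicoherent

end Quasicoherent

/-! ### Coherence of the extension of scalars -/

section FrameCentral

variable {X : TopCat.{u}} {R S : Sheaf (Opens.grothendieckTopology X) RingCat.{u}} {φ : R ⟶ S}
  {T : SheafOfModules.{u} R ⥤ SheafOfModules.{u} S}
  (adj : T ⊣ SheafOfModules.restrictScalars.{u} φ) {N : SheafOfModules.{u} R} {U V W : Opens X}

lemma Frame.tensorSum_smul_of_central (F : Frame φ U)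
    (hφ : ∀ (W : Opens X) r s, rapp φ W r * s = s * rapp φ W r) (h : W ≤ U) (r : RSec R W)
    (n : Fin F.rank → Sec N W) :
    F.tensorSum adj N h (r • n) = rapp φ W r • F.tensorSum adj N h n := by
  simp only [tensorSum_apply, Finset.smul_sum, smul_smul, Pi.smul_apply, tensorOne_smul, hφ]

lemma exists_le_forall {ι : Type*} [Finite ι] {x : X} (V : ι → Opens X) (hV : ∀ i, x ∈ V i)
    (hU : x ∈ U) : ∃ W ≤ U, x ∈ W ∧ ∀ i, W ≤ V i := by
  refine ⟨U ⊓ ⟨⋂ i, (V i : Set X), isOpen_iInter_of_finite fun i => (V i).2⟩, inf_le_left,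
    ⟨hU, Set.mem_iInter.2 hV⟩, fun i => inf_le_right.trans (Set.iInter_subset _ i)⟩

end FrameCentral

section Support

variable {X : Scheme.{u}}

lemma notMem_support_iff (M : SheafOfModules.{u} X.ringCatSheaf) (x : X) :
    x ∉ support (X := X) M ↔ ∀ (W : X.Opens) (s : Sec M W), x ∈ W →
      ∃ (V : X.Opens) (h : V ≤ W), x ∈ V ∧ res M h s = 0 := by
  let F : TopCat.Presheaf Ab.{u} X := Scheme.Modules.presheaf (X := X) M
  change ¬ Nontrivial (F.stalk x : Ab.{u}) ↔ _
  rw [not_nontrivial_iff_subsingleton]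
  constructor
  · intro h W s hx
    obtain ⟨V, hxV, i, j, e⟩ := F.germ_eq x hx hx s 0 (Subsingleton.elim _ _)
    exact ⟨V, leOfHom i, hxV, e.trans (map_zero (res M (leOfHom j)))⟩
  · intro h
    refine subsingleton_of_forall_eq 0 fun t => ?_
    obtain ⟨W, hx, s, rfl⟩ := F.exists_germ_eq t
    obtain ⟨V, hV, hxV, e⟩ := h W s hx
    rw [← F.germ_res_apply (homOfLE hV) x hxV s]
    exact (congrArg (F.germ V x hxV) e).trans (map_zero (F.germ V x hxV).hom)

end Support

section Finite

variable {R M : Type u} [CommRing R] [AddCommGroup M] [Module R M]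

/-- Finiteness of a module is local, with the localizations given by semilinear maps. -/
lemma finite_of_localizations {t : Set R} (ht : Ideal.span t = ⊤) (R' M' : t → Type u)
    [∀ g, CommRing (R' g)] [∀ g, Algebra R (R' g)] [∀ g, IsLocalization.Away g.1 (R' g)]
    [∀ g, AddCommGroup (M' g)] [∀ g, Module (R' g) (M' g)] [∀ g, Module.Finite (R' g) (M' g)]
    (f : ∀ g, M →+ M' g) (hf : ∀ g r m, f g (r • m) = algebraMap R (R' g) r • f g m)
    (hs : ∀ (g : t) (m' : M' g), ∃ (n : ℕ) (m : M), f g m = algebraMap R (R' g) (g.1 ^ n) • m')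
    (hz : ∀ (g : t) (m : M), f g m = 0 → ∃ n : ℕ, g.1 ^ n • m = 0) : Module.Finite R M := by
  let (g : t) : Module R (M' g) := Module.compHom (M' g) (algebraMap R (R' g))
  have (g : t) : IsScalarTower R (R' g) (M' g) := IsScalarTower.of_algebraMap_smul fun _ _ => rfl
  let f' (g : t) : M →ₗ[R] M' g := { f g with map_smul' := hf g }
  have (g : t) : IsLocalizedModule.Away g.1 (f' g) := by
    refine IsLocalizedModule.Away.mk_of_addCommGroup ?_ (fun x => ?_) (hz g)
    · have h := (IsLocalization.Away.algebraMap_isUnit (S := R' g) g.1).map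
        (algebraMap (R' g) (Module.End (R' g) (M' g)))
      rw [Module.End.isUnit_iff] at h ⊢
      exact h
    · obtain ⟨n, m, h⟩ := hs g x
      exact ⟨n, m, h.symm⟩
  exact Module.Finite.of_localizationSpan' t ht f' fun g => ‹∀ g, Module.Finite (R' g) (M' g)› g

end Finite

section Coherent

variable {X : Scheme.{u}}

/-- Finiteness over an affine open subset can be checked over small affine open subsets. -/
lemma finite_of_isLocalizingOn {M : X.Modules} {V : X.Opens}
    (hV : IsAffineOpen V) (hM : IsLocalizingOn M V)
    (h : ∀ x ∈ V, ∃ U : X.Opens, x ∈ U ∧ ∀ W ≤ U, IsAffineOpen W →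
      Module.Finite Γ(X, W) Γ(M, W)) :
    Module.Finite Γ(X, V) Γ(M, V) := by
  let t : Set Γ(X, V) := {f | Module.Finite Γ(X, X.basicOpen f) Γ(M, X.basicOpen f)}
  have ht : Ideal.span t = ⊤ := by
    rw [← hV.self_le_iSup_basicOpen_iff]
    intro x hx
    obtain ⟨U, hxU, hU⟩ := h x hx
    obtain ⟨f, hf, hxf⟩ := hV.exists_basicOpen_le ⟨x, hxU⟩ hx
    exact Opens.mem_iSup.2 ⟨⟨f, hU _ hf (hV.basicOpen f)⟩, hxf⟩
  have (g : t) : IsLocalization.Away g.1 Γ(X, X.basicOpen g.1) := hV.isLocalization_basicOpen g.1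
  have (g : t) : Module.Finite Γ(X, X.basicOpen g.1) Γ(M, X.basicOpen g.1) := g.2
  exact finite_of_localizations ht (fun g => Γ(X, X.basicOpen g.1))
    (fun g => Γ(M, X.basicOpen g.1)) (fun g => res (R := X.ringCatSheaf) M (X.basicOpen_le g.1))
    (fun g r m => res_smul _ _ _) (fun g => (hM g.1).1) (fun g => (hM g.1).2)

instance (Z : Set X) : (cohSupportedIn X Z).IsClosedUnderIsomorphisms where
  of_iso {M N} e hM := by
    have hsur (W : X.Opens) (s : Sec (R := X.ringCatSheaf) N W) :
        sapp (M := M) (N := N) e.hom W (sapp (M := N) (N := M) e.inv W s) = s := by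
      refine (sapp_comp (M := N) (N := M) (P := N) e.inv e.hom W s).symm.trans ?_
      exact congrArg (fun k : (show SheafOfModules X.ringCatSheaf from N) ⟶ N => sapp k W s)
        e.inv_hom_id
    refine ⟨⟨?_, fun U hU => ?_⟩, fun x hx => hM.2 ?_⟩
    · exact (SheafOfModules.isQuasicoherent.{u} X.ringCatSheaf).prop_of_iso
        ((show (show SheafOfModules X.ringCatSheaf from M) ≅ N from e)) hM.1.1
    · have := hM.1.2 U hU
      let g : Γ(M, U) →ₗ[Γ(X, U)] Γ(N, U) := sapp (R := X.ringCatSheaf) (M := M) (N := N) e.hom U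
      exact Module.Finite.of_surjective g fun s => ⟨_, hsur U s⟩
    · by_contra hxM
      refine (notMem_support_iff N x).2 (fun W s hxW => ?_) hx
      obtain ⟨V, hV, hxV, h0⟩ := (notMem_support_iff M x).1 hxM W (sapp e.inv W s) hxW
      refine ⟨V, hV, hxV, ?_⟩
      refine (congrArg (res (R := X.ringCatSheaf) N hV) (hsur W s)).symm.trans ?_
      refine (res_sapp (M := M) (N := N) e.hom hV _).trans ?_
      exact (congrArg (sapp (M := M) (N := N) e.hom V) h0).trans (map_zero _)

end Coherent

section Tensor

variable {X : Scheme.{u}} (𝒜 : SheafOfAlgebras X) {N : SheafOfModules.{u} X.ringCatSheaf}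
  {U V : X.Opens} (F : Frame 𝒜.strOp U)

lemma rapp_strOp_mul (W : X.Opens) (r : RSec X.ringCatSheaf W) (s : RSec (sheafOp 𝒜.ring) W) :
    rapp 𝒜.strOp W r * s = s * rapp 𝒜.strOp W r :=
  MulOpposite.unop_injective (𝒜.central W r s.unop).symm

include F in
/-- In a frame, the sections of `N ⊗ 𝒜` are families of sections of `N`, and powers of a section of
`𝒪_X` act on the coordinates since `𝒪_X` is central in `𝒜`. -/
lemma isLocalizingOn_tensor (hVU : V ≤ U) (hN : IsLocalizingOn N V) :
    IsLocalizingOn (𝒜.forgetful.obj (𝒜.tensor.obj N)) V := by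
  intro f
  have hD : X.basicOpen f ≤ U := (X.basicOpen_le f).trans hVU
  constructor
  · intro s
    obtain ⟨m, rfl⟩ := F.tensorSum_surjective 𝒜.tensorAdjunction hD s
    choose k t ht using fun i => (hN f).1 (m i)
    let K := Finset.univ.sup k
    have hk (i : Fin F.rank) : k i ≤ K := Finset.le_sup (Finset.mem_univ i)
    refine ⟨K, F.tensorSum 𝒜.tensorAdjunction N hVU fun i => f ^ (K - k i) • t i, ?_⟩
    refine (F.res_tensorSum _ _ _ _).trans (Eq.trans ?_
      (F.tensorSum_smul_of_central 𝒜.tensorAdjunction (rapp_strOp_mul 𝒜) hD _ m))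
    congr 1
    funext i
    rw [res_smul, ht, smul_smul, ← map_mul, ← pow_add, Nat.sub_add_cancel (hk i)]
    rfl
  · intro s hs
    obtain ⟨m, rfl⟩ := F.tensorSum_surjective 𝒜.tensorAdjunction hVU s
    have h0 := F.tensorSum_injective 𝒜.tensorAdjunction hD
      (((F.res_tensorSum 𝒜.tensorAdjunction hVU (X.basicOpen_le f) m).symm.trans hs).trans
        (map_zero _).symm)
    choose k hk using fun i => (hN f).2 (m i) (congrFun h0 i)
    refine ⟨Finset.univ.sup k, ?_⟩
    refine (F.tensorSum_smul_of_central 𝒜.tensorAdjunction (rapp_strOp_mul 𝒜) hVU _ m).symm.trans ?_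
    refine (congrArg (F.tensorSum 𝒜.tensorAdjunction N hVU) (funext fun i => ?_ :
      f ^ Finset.univ.sup k • m = 0)).trans (map_zero _)
    have hki : k i ≤ Finset.univ.sup k := Finset.le_sup (Finset.mem_univ i)
    rw [Pi.smul_apply, ← Nat.sub_add_cancel hki, pow_add, mul_smul, hk, smul_zero]
    rfl

variable (h𝒜 : ∀ x : X, ∃ U : X.Opens, x ∈ U ∧ Nonempty (Frame 𝒜.strOp U))

include h𝒜 in
lemma cohSupportedIn_tensor {Z : Set X} {N : X.Modules} (hN : cohSupportedIn X Z N) :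
    cohSupportedIn X Z (𝒜.forgetful.obj (𝒜.tensor.obj N)) := by
  have hq := hN.1.1
  have hM : SheafOfModules.IsQuasicoherent.{u}
      (show SheafOfModules X.ringCatSheaf from 𝒜.forgetful.obj (𝒜.tensor.obj N)) := by
    refine isQuasicoherent_of_isLocalizingOn fun x => ?_
    obtain ⟨U, hxU, ⟨F⟩⟩ := h𝒜 x
    obtain ⟨_, ⟨V, hV, rfl⟩, hxV, hVU⟩ := X.isBasis_affineOpens.exists_subset_of_mem_open hxU U.2
    exact ⟨V, hxV, hV, isLocalizingOn_tensor 𝒜 F hVU (.of_isQuasicoherent N hV)⟩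
  refine ⟨⟨hM, fun V hV => ?_⟩, fun x hx => hN.2 ?_⟩
  · refine finite_of_isLocalizingOn hV (.of_isQuasicoherent _ hV) fun x hx => ?_
    obtain ⟨U, hxU, ⟨F⟩⟩ := h𝒜 x
    refine ⟨U, hxU, fun W hWU hW => ?_⟩
    have := hN.1.2 W hW
    let g : (Fin F.rank → Γ(N, W)) →ₗ[Γ(X, W)] Γ(𝒜.forgetful.obj (𝒜.tensor.obj N), W) :=
      { toFun := F.tensorSum 𝒜.tensorAdjunction N hWU
        map_add' := map_add (F.tensorSum 𝒜.tensorAdjunction N hWU)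
        map_smul' := F.tensorSum_smul_of_central 𝒜.tensorAdjunction (rapp_strOp_mul 𝒜) hWU }
    exact Module.Finite.of_surjective g (F.tensorSum_surjective 𝒜.tensorAdjunction hWU)
  · by_contra hxN
    refine (notMem_support_iff _ x).2 (fun W s hxW => ?_) hx
    obtain ⟨U, hxU, ⟨F⟩⟩ := h𝒜 x
    obtain ⟨m, hm⟩ := F.tensorSum_surjective 𝒜.tensorAdjunction (N := N)
      (inf_le_right : W ⊓ U ≤ U) (res (𝒜.tensor.obj N) inf_le_left s)
    choose V hV hxV h0 using fun i => (notMem_support_iff N x).1 hxN _ (m i) ⟨hxW, hxU⟩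
    obtain ⟨W', hW', hxW', hle⟩ := exists_le_forall (U := W ⊓ U) V hxV ⟨hxW, hxU⟩
    refine ⟨W', hW'.trans inf_le_left, hxW', ?_⟩
    refine (res_res (M := 𝒜.tensor.obj N) inf_le_left hW' s).symm.trans ?_
    rw [← hm]
    have h0' : (fun i => res (R := X.ringCatSheaf) N hW' (m i)) = 0 := funext fun i =>
      (res_res (R := X.ringCatSheaf) (M := N) (hV i) (hle i) (m i)).symm.trans
        ((congrArg _ (h0 i)).trans (map_zero _))
    refine (F.res_tensorSum 𝒜.tensorAdjunction _ hW' m).trans ?_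
    exact (congrArg _ h0').trans (map_zero _)

end Tensor

/-! ### Splitting of the counit for separable algebras -/

section Separable

variable {X : TopCat.{u}} {R S : Sheaf (Opens.grothendieckTopology X) RingCat.{u}} {φ : R ⟶ S}
  {T : SheafOfModules.{u} R ⥤ SheafOfModules.{u} S}
  (adj : T ⊣ SheafOfModules.restrictScalars.{u} φ)
  {P Q : SheafOfModules.{u} S} {U V W : Opens X}

/-- A module is supported in an open subset `U` if its sections vanish locally outside of `U`. -/
def SupportedIn (P : SheafOfModules.{u} S) (U : Opens X) : Prop :=
  ∀ (W : Opens X) (p : Sec P W), ∀ x ∈ W, x ∉ U →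
    ∃ (V : Opens X) (h : V ≤ W), x ∈ V ∧ res P h p = 0

/-- A separability element `∑ xₗ ⊗ yₗ` of `S` over `R` on `U`: the product `∑ xₗ yₗ` is `1` and
`∑ s xₗ ⊗ yₗ = ∑ xₗ ⊗ yₗ s`. The latter is formulated as an equality, locally on `U`, of the values
of all balanced biadditive maps, as `R` is not assumed commutative or central, so that `S ⊗_R S` is
not at hand. -/
structure Separability (φ : R ⟶ S) (U : Opens X) where
  /-- the index set of the sum -/
  ι : Type u
  [fintype : Fintype ι]
  /-- the left factors -/
  x : ι → RSec S U
  /-- the right factors -/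
  y : ι → RSec S U
  sum_mul : ∑ l, x l * y l = 1
  comm {W : Opens X} (h : W ≤ U) (s : RSec S W) {z : X} (hz : z ∈ W) :
    ∃ (V : Opens X) (h' : V ≤ W), z ∈ V ∧
      ∀ (G : Type u) [AddCommGroup G] (B : RSec S V →+ RSec S V →+ G),
        (∀ a r b, B (a * rapp φ V r) b = B a (rapp φ V r * b)) →
          ∑ l, B (rres S h' s * rres S (h'.trans h) (x l)) (rres S (h'.trans h) (y l)) =
            ∑ l, B (rres S (h'.trans h) (x l)) (rres S (h'.trans h) (y l) * rres S h' s)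

attribute [instance] Separability.fintype

/-- The map `p ↦ 1 ⊗ p` from an `S`-module `P` to the extension of scalars of its restriction of
scalars, on sections. Its source is the group of sections of `P`, with its `S`-module structure,
rather than that of the restriction of scalars of `P`. -/
def tensorOneOf (P : SheafOfModules.{u} S) (W : Opens X) :
    Sec P W →+ Sec (T.obj ((SheafOfModules.restrictScalars.{u} φ).obj P)) W :=
  tensorOne adj ((SheafOfModules.restrictScalars.{u} φ).obj P) W

lemma tensorOneOf_smul (r : RSec R W) (p : Sec P W) :
    tensorOneOf adj P W (rapp φ W r • p) = rapp φ W r • tensorOneOf adj P W p :=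
  tensorOne_smul adj r (N := (SheafOfModules.restrictScalars.{u} φ).obj P) p

@[simp]
lemma res_tensorOneOf (h : V ≤ W) (p : Sec P W) :
    res _ h (tensorOneOf adj P W p) = tensorOneOf adj P V (res P h p) :=
  res_tensorOne adj (N := (SheafOfModules.restrictScalars.{u} φ).obj P) h p

@[simp]
lemma sapp_map_tensorOneOf (f : P ⟶ Q) (p : Sec P W) :
    sapp (T.map ((SheafOfModules.restrictScalars.{u} φ).map f)) W (tensorOneOf adj P W p) =
      tensorOneOf adj Q W (sapp f W p) :=
  sapp_map_tensorOne adj ((SheafOfModules.restrictScalars.{u} φ).map f) p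

/-- The action map `s ⊗ p ↦ s p`, that is, the counit of the adjunction. -/
def action (P : SheafOfModules.{u} S) :
    T.obj ((SheafOfModules.restrictScalars.{u} φ).obj P) ⟶ P := adj.counit.app P

@[simp]
lemma sapp_action_tensorOneOf (p : Sec P W) :
    sapp (action adj P) W (tensorOneOf adj P W p) = p :=
  sapp_counit_tensorOne adj p

namespace Separability

variable (E : Separability φ U)

/-- The section `p ↦ ∑ xₗ ⊗ yₗ p` of the action map, over the open subsets of `U`. -/
def localSection (P : SheafOfModules.{u} S) (h : W ≤ U) :
    Sec P W →+ Sec (T.obj ((SheafOfModules.restrictScalars.{u} φ).obj P)) W where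
  toFun p := ∑ l, rres S h (E.x l) • tensorOneOf adj P W (rres S h (E.y l) • p)
  map_zero' := by simp
  map_add' p p' := by simp [smul_add, Finset.sum_add_distrib]

lemma localSection_apply (h : W ≤ U) (p : Sec P W) :
    E.localSection adj P h p =
      ∑ l, rres S h (E.x l) • tensorOneOf adj P W (rres S h (E.y l) • p) := rfl

lemma res_localSection (h : W ≤ U) (h' : V ≤ W) (p : Sec P W) :
    res _ h' (E.localSection adj P h p) = E.localSection adj P (h'.trans h) (res P h' p) := by
  simp [localSection_apply]

/-- The biadditive map `(a, b) ↦ a ⊗ b p`. -/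
def actionPairing (p : Sec P W) : RSec S W →+ RSec S W →+
    Sec (T.obj ((SheafOfModules.restrictScalars.{u} φ).obj P)) W :=
  AddMonoidHom.mk' (fun a => AddMonoidHom.mk' (fun b => a • tensorOneOf adj P W (b • p))
    fun b b' => by rw [add_smul, map_add, smul_add]) fun a a' => by ext b; exact add_smul a a' _

lemma actionPairing_apply (p : Sec P W) (a b : RSec S W) :
    actionPairing adj p a b = a • tensorOneOf adj P W (b • p) := rfl

/-- The map `p ↦ ∑ xₗ ⊗ yₗ p` is `S`-linear: apply the commutation property of the separability
element to the pairing `(a, b) ↦ a ⊗ b p`. -/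
lemma localSection_smul (h : W ≤ U) (s : RSec S W) (p : Sec P W) :
    E.localSection adj P h (s • p) = s • E.localSection adj P h p := by
  refine sec_ext fun z hz => ?_
  obtain ⟨V, hV, hzV, key⟩ := E.comm h s hz
  refine ⟨V, hV, hzV, ?_⟩
  have := key _ (actionPairing adj (res P hV p)) (fun a r b => by
    rw [actionPairing_apply, actionPairing_apply, mul_smul, mul_smul, tensorOneOf_smul])
  simp only [actionPairing_apply, mul_smul, ← Finset.smul_sum] at this
  rw [res_smul, res_localSection, res_localSection, res_smul, localSection_apply,
    localSection_apply, this]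

lemma sapp_action_localSection (h : W ≤ U) (p : Sec P W) :
    sapp (action adj P) W (E.localSection adj P h p) = p := by
  simp only [localSection_apply, map_sum, map_smul, sapp_action_tensorOneOf, smul_smul,
    ← Finset.sum_smul, ← map_mul]
  rw [← map_sum, E.sum_mul, map_one, one_smul]

lemma sapp_map_localSection (h : W ≤ U) (f : P ⟶ Q) (p : Sec P W) :
    sapp (T.map ((SheafOfModules.restrictScalars.{u} φ).map f)) W (E.localSection adj P h p) =
      E.localSection adj Q h (sapp f W p) := by
  simp [localSection_apply]

/-- The section `t` is the extension by zero of `∑ xₗ ⊗ yₗ p`, which is defined only over `U`. -/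
def IsExtension (p : Sec P W)
    (t : Sec (T.obj ((SheafOfModules.restrictScalars.{u} φ).obj P)) W) : Prop :=
  (∀ (V : Opens X) (h : V ≤ W) (h' : V ≤ U), res _ h t = E.localSection adj P h' (res P h p)) ∧
    ∀ x ∈ W, x ∉ U → ∃ (V : Opens X) (h : V ≤ W), x ∈ V ∧ res _ h t = 0

variable {adj E}

lemma IsExtension.unique {p : Sec P W}
    {t t' : Sec (T.obj ((SheafOfModules.restrictScalars.{u} φ).obj P)) W}
    (ht : E.IsExtension adj p t) (ht' : E.IsExtension adj p t') : t = t' := by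
  refine sec_ext fun x hx => ?_
  by_cases hxU : x ∈ U
  · refine ⟨W ⊓ U, inf_le_left, ⟨hx, hxU⟩, ?_⟩
    rw [ht.1 _ _ inf_le_right, ht'.1 _ _ inf_le_right]
  · obtain ⟨V, hV, hxV, h0⟩ := ht.2 x hx hxU
    obtain ⟨V', hV', hxV', h0'⟩ := ht'.2 x hx hxU
    refine ⟨V ⊓ V', inf_le_left.trans hV, ⟨hxV, hxV'⟩, ?_⟩
    rw [← res_res hV inf_le_left, h0, ← res_res hV' inf_le_right, h0', map_zero, map_zero]

lemma IsExtension.add {p p' : Sec P W}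
    {t t' : Sec (T.obj ((SheafOfModules.restrictScalars.{u} φ).obj P)) W}
    (ht : E.IsExtension adj p t) (ht' : E.IsExtension adj p' t') :
    E.IsExtension adj (p + p') (t + t') := by
  refine ⟨fun V h h' => ?_, fun x hx hxU => ?_⟩
  · rw [map_add, ht.1 V h h', ht'.1 V h h', map_add, map_add]
  · obtain ⟨V, hV, hxV, h0⟩ := ht.2 x hx hxU
    obtain ⟨V', hV', hxV', h0'⟩ := ht'.2 x hx hxU
    refine ⟨V ⊓ V', inf_le_left.trans hV, ⟨hxV, hxV'⟩, ?_⟩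
    rw [map_add, ← res_res hV inf_le_left, h0, ← res_res hV' inf_le_right t', h0', map_zero,
      map_zero, add_zero]

lemma IsExtension.smul {p : Sec P W}
    {t : Sec (T.obj ((SheafOfModules.restrictScalars.{u} φ).obj P)) W}
    (ht : E.IsExtension adj p t) (s : RSec S W) : E.IsExtension adj (s • p) (s • t) := by
  refine ⟨fun V h h' => ?_, fun x hx hxU => ?_⟩
  · rw [res_smul, ht.1 V h h', res_smul, localSection_smul]
  · obtain ⟨V, hV, hxV, h0⟩ := ht.2 x hx hxU
    exact ⟨V, hV, hxV, by rw [res_smul, h0, smul_zero]⟩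

lemma IsExtension.res {p : Sec P W}
    {t : Sec (T.obj ((SheafOfModules.restrictScalars.{u} φ).obj P)) W}
    (ht : E.IsExtension adj p t) (h : V ≤ W) :
    E.IsExtension adj (res P h p) (AzumayaGen.res _ h t) := by
  refine ⟨fun V' k k' => ?_, fun x hx hxU => ?_⟩
  · rw [res_res, ht.1 V' (k.trans h) k', res_res]
  · obtain ⟨V', hV', hxV, h0⟩ := ht.2 x (h hx) hxU
    refine ⟨V' ⊓ V, inf_le_right, ⟨hxV, hx⟩, ?_⟩
    rw [res_res, ← res_res hV' inf_le_left, h0, map_zero]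

lemma IsExtension.map {p : Sec P W}
    {t : Sec (T.obj ((SheafOfModules.restrictScalars.{u} φ).obj P)) W}
    (ht : E.IsExtension adj p t) (f : P ⟶ Q) : E.IsExtension adj (sapp f W p)
      (sapp (T.map ((SheafOfModules.restrictScalars.{u} φ).map f)) W t) := by
  refine ⟨fun V h h' => ?_, fun x hx hxU => ?_⟩
  · rw [res_sapp, ht.1 V h h', sapp_map_localSection, res_sapp]
  · obtain ⟨V, hV, hxV, h0⟩ := ht.2 x hx hxU
    exact ⟨V, hV, hxV, by rw [res_sapp, h0, map_zero]⟩

lemma IsExtension.sapp_action (hP : SupportedIn P U) {p : Sec P W}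
    {t : Sec (T.obj ((SheafOfModules.restrictScalars.{u} φ).obj P)) W}
    (ht : E.IsExtension adj p t) : sapp (action adj P) W t = p := by
  refine sec_ext fun x hx => ?_
  by_cases hxU : x ∈ U
  · refine ⟨W ⊓ U, inf_le_left, ⟨hx, hxU⟩, ?_⟩
    rw [res_sapp, ht.1 _ _ inf_le_right, sapp_action_localSection]
  · obtain ⟨V, hV, hxV, h0⟩ := ht.2 x hx hxU
    obtain ⟨V', hV', hxV', h0'⟩ := hP W p x hx hxU
    refine ⟨V ⊓ V', inf_le_left.trans hV, ⟨hxV, hxV'⟩, ?_⟩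
    rw [res_sapp, ← res_res hV inf_le_left, h0, ← res_res hV' inf_le_right, h0', map_zero,
      map_zero, map_zero]

variable (adj E)

lemma exists_isExtension (hP : SupportedIn P U) (p : Sec P W) :
    ∃ t : Sec (T.obj ((SheafOfModules.restrictScalars.{u} φ).obj P)) W,
      E.IsExtension adj p t := by
  -- near each point, either `U` contains the neighbourhood or `p` vanishes
  have key (x : W) : ∃ (V : Opens X) (_ : V ≤ W),
      ∃ t : Sec (T.obj ((SheafOfModules.restrictScalars.{u} φ).obj P)) V, x.1 ∈ V ∧
        (∀ (V' : Opens X) (h : V' ≤ V) (h' : V' ≤ U) (k : V' ≤ W),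
          res _ h t = E.localSection adj P h' (res P k p)) ∧
        (V ≤ U ∨ t = 0) := by
    by_cases hxU : x.1 ∈ U
    · refine ⟨W ⊓ U, inf_le_left, E.localSection adj P inf_le_right (res P inf_le_left p),
        ⟨x.2, hxU⟩, fun V' h h' k => ?_, Or.inl inf_le_right⟩
      rw [res_localSection, res_res]
    · obtain ⟨V, hV, hxV, h0⟩ := hP W p x.1 x.2 hxU
      refine ⟨V, hV, 0, hxV, fun V' h h' k => ?_, Or.inr rfl⟩
      rw [← res_res hV h, h0, map_zero, map_zero, map_zero]
  choose V hV t hxV ht hor using key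
  obtain ⟨t', ht'⟩ := exists_glue (M := T.obj ((SheafOfModules.restrictScalars.{u} φ).obj P)) V hV
    (fun x hx => Opens.mem_iSup.2 ⟨⟨x, hx⟩, hxV _⟩) t fun x y => by
      rcases hor x with hx | hx
      · rw [ht x _ _ (inf_le_left.trans hx) (inf_le_left.trans (hV x)),
          ht y _ _ (inf_le_left.trans hx) (inf_le_left.trans (hV x))]
      · rcases hor y with hy | hy
        · rw [ht x _ _ (inf_le_right.trans hy) (inf_le_left.trans (hV x)),
            ht y _ _ (inf_le_right.trans hy) (inf_le_left.trans (hV x))]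
        · rw [hx, hy, map_zero, map_zero]
  refine ⟨t', fun V' h h' => sec_ext fun x hx => ?_, fun x hx hxU => ?_⟩
  · refine ⟨V' ⊓ V ⟨x, h hx⟩, inf_le_left, ⟨hx, hxV _⟩, ?_⟩
    rw [res_res, res_localSection, res_res, ← ht ⟨x, h hx⟩ (V' ⊓ V ⟨x, h hx⟩) inf_le_right, ← ht',
      res_res]
  · refine ⟨V ⟨x, hx⟩, hV _, hxV _, ?_⟩
    rw [ht']
    exact (hor ⟨x, hx⟩).resolve_left fun hle => hxU (hle (hxV _))

/-- Over modules supported in `U`, a separability element on `U` gives a natural section of the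
counit of extension and restriction of scalars. -/
def counitSection (hP : SupportedIn P U) :
    P ⟶ T.obj ((SheafOfModules.restrictScalars.{u} φ).obj P) :=
  homMkSec (fun _ p => (E.exists_isExtension adj hP p).choose)
    (fun _ p p' => (E.exists_isExtension adj hP (p + p')).choose_spec.unique
      ((E.exists_isExtension adj hP p).choose_spec.add
        (E.exists_isExtension adj hP p').choose_spec))
    (fun _ s p => (E.exists_isExtension adj hP (s • p)).choose_spec.unique
      ((E.exists_isExtension adj hP p).choose_spec.smul s))
    (fun h p => ((E.exists_isExtension adj hP p).choose_spec.res h).unique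
      (E.exists_isExtension adj hP (res P h p)).choose_spec)

lemma isExtension_counitSection (hP : SupportedIn P U) (p : Sec P W) :
    E.IsExtension adj p (sapp (E.counitSection adj hP) W p) :=
  (E.exists_isExtension adj hP p).choose_spec

lemma counitSection_counit (hP : SupportedIn P U) :
    E.counitSection adj hP ≫ adj.counit.app P = 𝟙 P :=
  hom_ext_sapp fun _ p => (E.isExtension_counitSection adj hP p).sapp_action hP

lemma counitSection_naturality (hP : SupportedIn P U) (hQ : SupportedIn Q U) (f : P ⟶ Q) :
    E.counitSection adj hP ≫ T.map ((SheafOfModules.restrictScalars.{u} φ).map f) =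
      f ≫ E.counitSection adj hQ :=
  hom_ext_sapp fun _ p => ((E.isExtension_counitSection adj hP p).map f).unique
    (E.isExtension_counitSection adj hQ _)

/-- The separability element on the empty set. -/
def bot (φ : R ⟶ S) : Separability φ ⊥ where
  ι := PEmpty
  x := PEmpty.elim
  y := PEmpty.elim
  sum_mul := sec_ext (M := SheafOfModules.unit S) fun _ hx => hx.elim
  comm h _ _ hz := (h hz).elim

end Separability

/-- The sections which vanish locally outside of `U`. -/
def sectionsSupportedIn (P : SheafOfModules.{u} S) (U : Opens X) : Subsheaf P where
  carrier W :=
    { carrier := {p | ∀ x ∈ W, x ∉ U → ∃ (V : Opens X) (h : V ≤ W), x ∈ V ∧ res P h p = 0}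
      zero_mem' := fun x hx _ => ⟨W, le_rfl, hx, map_zero _⟩
      add_mem' := fun {p p'} hp hp' x hx hxU => by
        obtain ⟨V, hV, hxV, h0⟩ := hp x hx hxU
        obtain ⟨V', hV', hxV', h0'⟩ := hp' x hx hxU
        refine ⟨V ⊓ V', inf_le_left.trans hV, ⟨hxV, hxV'⟩, ?_⟩
        rw [map_add, ← res_res hV inf_le_left, h0, ← res_res hV' inf_le_right p', h0', map_zero,
          map_zero, add_zero]
      smul_mem' := fun s p hp x hx hxU => by
        obtain ⟨V, hV, hxV, h0⟩ := hp x hx hxU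
        exact ⟨V, hV, hxV, by rw [res_smul, h0, smul_zero]⟩ }
  res_mem {W V} h p hp x hx hxU := by
    obtain ⟨V', hV', hxV, h0⟩ := hp x (h hx) hxU
    exact ⟨V' ⊓ V, inf_le_right, ⟨hxV, hx⟩, by
      rw [res_res, ← res_res hV' inf_le_left, h0, map_zero]⟩
  local_mem {W p} hp x hx hxU := by
    obtain ⟨V, hV, hxV, hp'⟩ := hp x hx
    obtain ⟨V', hV', hxV', h0⟩ := hp' x hxV hxU
    exact ⟨V', hV'.trans hV, hxV', by rw [← res_res hV hV', h0]⟩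

lemma exists_sectionsSupportedIn_map (f : P ⟶ Q) (U : Opens X) :
    ∃ g : (sectionsSupportedIn P U).toSheafOfModules ⟶ (sectionsSupportedIn Q U).toSheafOfModules,
      g ≫ (sectionsSupportedIn Q U).ι = (sectionsSupportedIn P U).ι ≫ f := by
  refine Subsheaf.exists_lift _ _ fun W p x hx hxU => ?_
  obtain ⟨V, hV, hxV, h0⟩ := (sectionsSupportedIn P U).sapp_ι_mem W p x hx hxU
  exact ⟨V, hV, hxV, by rw [sapp_comp, res_sapp, h0, map_zero]⟩

lemma supportedIn_sectionsSupportedIn (P : SheafOfModules.{u} S) (U : Opens X) :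
    SupportedIn (sectionsSupportedIn P U).toSheafOfModules U := fun W p x hx hxU => by
  obtain ⟨V, hV, hxV, h0⟩ := (sectionsSupportedIn P U).sapp_ι_mem W p x hx hxU
  refine ⟨V, hV, hxV, (sectionsSupportedIn P U).sapp_ι_injective V ?_⟩
  rw [← res_sapp, h0, map_zero]

/-- The quotient by the sections supported in `V` of a module supported in `V ∪ U` is supported
in `U`: over `V` every section is killed. -/
lemma supportedIn_of_epi {P' : SheafOfModules.{u} S} (hP : SupportedIn P (V ⊔ U))
    (g : P ⟶ P') [Epi g] (hg : (sectionsSupportedIn P V).ι ≫ g = 0) : SupportedIn P' U := by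
  intro W q x hx hxU
  obtain ⟨W', h, hxW', p, hp⟩ := exists_local_preimage_of_epi g q hx
  by_cases hxV : x ∈ V
  · refine ⟨W' ⊓ V, inf_le_left.trans h, ⟨hxW', hxV⟩, ?_⟩
    obtain ⟨p', hp'⟩ := (sectionsSupportedIn P V).exists_sapp_ι_eq
      (m := res P (inf_le_left : W' ⊓ V ≤ W') p) fun z hz hzV => (hzV hz.2).elim
    rw [← res_res h inf_le_left, ← hp, res_sapp, ← hp', ← sapp_comp, hg, zero_sapp]
  · obtain ⟨V', hV', hxV', h0⟩ := hP W' p x hxW' fun hx' => hx'.elim hxV hxU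
    refine ⟨V', hV'.trans h, hxV', ?_⟩
    rw [← res_res h hV', ← hp, res_sapp, h0, map_zero]

lemma filteredCounitSplit_of_supportedIn (E : Separability φ U)
    (K : CochainComplex (SheafOfModules.{u} S) ℤ) (hK : ∀ n, SupportedIn (K.X n) U) :
    FilteredCounitSplit adj K :=
  .split K (fun n => E.counitSection adj (hK n)) (fun n => E.counitSection_counit adj (hK n))
    fun i j => E.counitSection_naturality adj (hK i) (hK j) (K.d i j)

/-- A complex supported in `V ∪ U` is an extension of a complex supported in `U` by
its subcomplex of sections supported in `V`. -/
lemma filteredCounitSplit_sup (E : Separability φ U)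
    (hV : ∀ K : CochainComplex (SheafOfModules.{u} S) ℤ, (∀ n, SupportedIn (K.X n) V) →
      FilteredCounitSplit adj K)
    (K : CochainComplex (SheafOfModules.{u} S) ℤ) (hK : ∀ n, SupportedIn (K.X n) (V ⊔ U)) :
    FilteredCounitSplit adj K := by
  let D (n : ℤ) := sectionsSupportedIn (K.X n) V
  choose d hd using fun i j => exists_sectionsSupportedIn_map (K.d i j) V
  let K' : CochainComplex (SheafOfModules.{u} S) ℤ :=
    { X n := (D n).toSheafOfModules
      d := d
      shape i j hij := by rw [← cancel_mono (D j).ι, hd, K.shape i j hij, comp_zero, zero_comp]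
      d_comp_d' i j k _ _ := by
        rw [← cancel_mono (D k).ι, Category.assoc, hd, reassoc_of% hd, K.d_comp_d, comp_zero,
          zero_comp] }
  let i : K' ⟶ K := { f n := (D n).ι, comm' i j _ := (hd i j).symm }
  have : Mono i := HomologicalComplex.mono_of_mono_f i fun n => inferInstanceAs (Mono (D n).ι)
  let S : ShortComplex (CochainComplex (SheafOfModules.{u} S) ℤ) :=
    ShortComplex.mk i (cokernel.π i) (cokernel.condition i)
  have hS : S.ShortExact :=
    { exact := ShortComplex.exact_cokernel i }
  refine .ext S hS (hV K' fun n => supportedIn_sectionsSupportedIn _ _)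
    (filteredCounitSplit_of_supportedIn adj E _ fun n => ?_)
  have : Epi ((cokernel.π i).f n) := inferInstance
  exact supportedIn_of_epi (hK n) ((cokernel.π i).f n)
    (congrArg (fun k : K' ⟶ cokernel i => k.f n) (cokernel.condition i))

/-- By compactness and induction on the number of open subsets carrying separability elements. -/
lemma filteredCounitSplit_of_cover [CompactSpace X]
    (hφ : ∀ x : X, ∃ U : Opens X, x ∈ U ∧ Nonempty (Separability φ U))
    (K : CochainComplex (SheafOfModules.{u} S) ℤ) : FilteredCounitSplit adj K := by
  choose U hxU E using hφ
  have key (s : Finset X) (K : CochainComplex (SheafOfModules.{u} S) ℤ)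
      (hK : ∀ n, SupportedIn (K.X n) (s.sup U)) : FilteredCounitSplit adj K := by
    classical
    induction s using Finset.induction_on generalizing K with
    | empty => exact filteredCounitSplit_of_supportedIn adj (Separability.bot φ) K hK
    | insert x s _ ih =>
      exact filteredCounitSplit_sup adj (E x).some ih K fun n => by
        rw [sup_comm, ← Finset.sup_insert]
        exact hK n
  obtain ⟨s, hs⟩ := CompactSpace.elim_nhds_subcover (fun x => (U x : Set X))
    fun x => (U x).2.mem_nhds (hxU x)
  refine key s K fun n W p x hx hxU => (hxU ?_).elim
  have : x ∈ ⋃ y ∈ s, (U y : Set X) := hs ▸ trivial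
  obtain ⟨y, hy, hxy⟩ := Set.mem_iUnion₂.1 this
  exact (Finset.le_sup (f := U) hy : U y ≤ s.sup U) hxy

end Separable

/-! ### Local bases of coherent modules -/

section ClearDenominators

variable {R M : Type u} [CommRing R] [AddCommGroup M] [Module R M]

/-- If `M_f` is free, it has a basis consisting of images of elements of `M`. -/
lemma exists_basis_of_free_away [Module.Finite R M] (f : R)
    [Module.Free (Localization (Submonoid.powers f)) (LocalizedModule.Away f M)] :
    ∃ (r : ℕ) (b : Fin r → M),
      (∀ m : M, ∃ (k : ℕ) (c : Fin r → R), f ^ k • m = ∑ i, c i • b i) ∧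
      ∀ c : Fin r → R, ∑ i, c i • b i = 0 → ∀ i, ∃ k : ℕ, f ^ k * c i = 0 := by
  let S := Submonoid.powers f
  let Rf := Localization S
  let Mf := LocalizedModule S M
  let j : M →ₗ[R] Mf := LocalizedModule.mkLinearMap S M
  have : Module.Free Rf Mf := ‹_›
  have : Module.Finite Rf Mf := Module.Finite.of_isLocalizedModule S j
  let B₀ := Module.Free.chooseBasis Rf Mf
  let B := B₀.reindex (Fintype.equivFin _)
  choose m hm using fun i => IsLocalizedModule.surj S j (B i)
  have hB (i) : B i = IsLocalization.mk' Rf 1 (m i).2 • j (m i).1 := by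
    rw [← hm, Submonoid.smul_def, ← algebraMap_smul Rf ((m i).2 : R) (B i), smul_smul,
      IsLocalization.mk'_spec, map_one, one_smul]
  refine ⟨_, fun i => (m i).1, fun x => ?_, fun c hc i => ?_⟩
  · obtain ⟨s, hs⟩ := IsLocalization.exist_integer_multiples_of_finite S
      fun i => B.repr (j x) i * IsLocalization.mk' Rf 1 (m i).2
    choose c hc using hs
    have h1 : j (s.1 • x) = j (∑ i, c i • (m i).1) := by
      rw [map_smul, map_sum]
      conv_lhs => rw [← B.sum_repr (j x), Finset.smul_sum]
      refine Finset.sum_congr rfl fun i _ => ?_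
      rw [map_smul, ← algebraMap_smul Rf (c i), hc, hB, smul_smul, smul_assoc]
    obtain ⟨t, ht⟩ := (IsLocalizedModule.eq_iff_exists S j).1 h1
    obtain ⟨n, hn⟩ := (t * s).2
    refine ⟨n, fun i => t.1 * c i, ?_⟩
    have hn' : f ^ n = t.1 * s.1 := hn
    simp only [hn', mul_smul, ← Finset.smul_sum]
    exact ht
  · have h1 : ∑ i, (algebraMap R Rf (c i) * algebraMap R Rf (m i).2) • B i = 0 := by
      have := congrArg j hc
      rw [map_sum, map_zero] at this
      rw [← this]
      refine Finset.sum_congr rfl fun i _ => ?_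
      rw [map_smul, ← hm, Submonoid.smul_def, mul_smul, algebraMap_smul, algebraMap_smul]
    have h2 := Fintype.linearIndependent_iff.1 B.linearIndependent _ h1 i
    rw [← map_mul, IsLocalization.map_eq_zero_iff S] at h2
    obtain ⟨⟨_, k, rfl⟩, hk⟩ := h2
    obtain ⟨l, hl⟩ := (m i).2.2
    refine ⟨k + l, ?_⟩
    rw [pow_add, ← hk, ← hl]
    ring

/-- If `b` becomes a basis of `M` after inverting `f`, then it becomes a basis over any
localization `O'` of `R` at one element `h` in which `f` is invertible. -/
lemma bijective_sum_smul_of_localization {O' M' : Type u} [CommRing O'] [AddCommGroup M']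
    [Module O' M'] (ρ : R →+* O') (σ : M →+ M') (hσ : ∀ r m, σ (r • m) = ρ r • σ m) (f h : R)
    (hf : IsUnit (ρ f)) (hh : IsUnit (ρ h))
    (hO : ∀ c : O', ∃ (n : ℕ) (t : R), ρ t = ρ (h ^ n) * c)
    (hM : ∀ s : M', ∃ (n : ℕ) (t : M), σ t = ρ (h ^ n) • s)
    (hM' : ∀ t : M, σ t = 0 → ∃ n : ℕ, h ^ n • t = 0) {r : ℕ} (b : Fin r → M)
    (hb : ∀ m : M, ∃ (k : ℕ) (c : Fin r → R), f ^ k • m = ∑ i, c i • b i)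
    (hb' : ∀ c : Fin r → R, ∑ i, c i • b i = 0 → ∀ i, ∃ k : ℕ, f ^ k * c i = 0) :
    Function.Bijective fun c : Fin r → O' => ∑ i, c i • σ (b i) := by
  have hunit (k n : ℕ) : IsUnit (ρ (f ^ k * h ^ n)) := by
    rw [map_mul, map_pow, map_pow]
    exact (hf.pow k).mul (hh.pow n)
  constructor
  · let L : (Fin r → O') →+ M' :=
      { toFun c := ∑ i, c i • σ (b i)
        map_zero' := by simp
        map_add' c c' := by simp [add_smul, Finset.sum_add_distrib] }
    refine (injective_iff_map_eq_zero L).2 fun c hc => ?_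
    have hc : ∑ i, c i • σ (b i) = 0 := hc
    choose n t ht using fun i => hO (c i)
    let K := Finset.univ.sup n
    have hK (i) : n i ≤ K := Finset.le_sup (Finset.mem_univ i)
    have ht' (i) : ρ (h ^ (K - n i) * t i) = ρ (h ^ K) * c i := by
      rw [map_mul, ht, ← mul_assoc, ← map_mul, ← pow_add, Nat.sub_add_cancel (hK i)]
    obtain ⟨N, hN⟩ := hM' (∑ i, (h ^ (K - n i) * t i) • b i) (by
      simp only [map_sum, hσ, ht']
      simp only [mul_smul]
      rw [← Finset.smul_sum, hc, smul_zero])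
    rw [Finset.smul_sum] at hN
    simp only [smul_smul] at hN
    funext i
    obtain ⟨k, hk⟩ := hb' _ hN i
    have h0 := congrArg ρ hk
    rw [map_zero, ← mul_assoc, map_mul, ht', ← mul_assoc, ← map_mul, mul_assoc, ← pow_add] at h0
    exact (hunit k (N + K)).mul_right_eq_zero.1 h0
  · intro s
    obtain ⟨n, t, ht⟩ := hM s
    obtain ⟨k, c, hc⟩ := hb t
    obtain ⟨v, hv⟩ := (hunit k n).exists_left_inv
    refine ⟨fun i => v * ρ (c i), ?_⟩
    have h1 := congrArg σ hc
    rw [hσ, ht, smul_smul, ← map_mul, map_sum] at h1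
    simp only [mul_smul, ← Finset.smul_sum, ← hσ, ← h1]
    rw [smul_smul, hv, one_smul]

end ClearDenominators

section Glue

variable {X : TopCat.{u}} {R : Sheaf (Opens.grothendieckTopology X) RingCat.{u}}
  {M : SheafOfModules.{u} R} {V W : Opens X} {r : ℕ}

/-- The linear combinations of a family of sections over an open subset. -/
def linComb (b : Fin r → Sec M V) (h : W ≤ V) : (Fin r → RSec R W) →+ Sec M W where
  toFun c := ∑ i, c i • res M h (b i)
  map_zero' := by simp
  map_add' c c' := by simp [add_smul, Finset.sum_add_distrib]

lemma res_linComb (b : Fin r → Sec M V) {W' : Opens X} (h : W ≤ V) (h' : W' ≤ W)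
    (c : Fin r → RSec R W) :
    res M h' (linComb b h c) = linComb b (h'.trans h) fun i => rres R h' (c i) := by
  simp [linComb]

lemma linComb_injective_of_local (b : Fin r → Sec M V) (h : W ≤ V)
    (H : ∀ x ∈ W, ∃ (D : Opens X) (h' : D ≤ W), x ∈ D ∧
      Function.Injective (linComb b (h'.trans h))) :
    Function.Injective (linComb b h) := by
  intro c c' e
  funext i
  refine sec_ext (M := SheafOfModules.unit R) fun x hx => ?_
  obtain ⟨D, hD, hxD, hinj⟩ := H x hx
  have e' := congrArg (res M hD) e
  rw [res_linComb, res_linComb] at e'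
  exact ⟨D, hD, hxD, congrFun (hinj e') i⟩

/-- A family of sections which is a basis over small open subsets is a basis: the coordinates glue,
being unique. -/
lemma linComb_bijective_of_local (b : Fin r → Sec M V) (h : W ≤ V)
    (H : ∀ (W' : Opens X) (h' : W' ≤ W), ∀ x ∈ W', ∃ (D : Opens X) (hD : D ≤ W'), x ∈ D ∧
      Function.Bijective (linComb b ((hD.trans h').trans h))) :
    Function.Bijective (linComb b h) := by
  have hinj (W' : Opens X) (h' : W' ≤ W) : Function.Injective (linComb b (h'.trans h)) :=
    linComb_injective_of_local b _ fun x hx => by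
      obtain ⟨D, hD, hxD, hbij⟩ := H W' h' x hx
      exact ⟨D, hD, hxD, hbij.1⟩
  refine ⟨hinj W le_rfl, fun s => ?_⟩
  choose D hD hxD hbij using fun x : W => H W le_rfl x.1 x.2
  choose c hc using fun x => (hbij x).2 (res M (hD x) s)
  have hglue (i : Fin r) : ∃ t : RSec R W, ∀ x, rres R (hD x) t = c x i :=
    exists_glue (M := SheafOfModules.unit R) D hD
      (fun x hx => Opens.mem_iSup.2 ⟨⟨x, hx⟩, hxD ⟨x, hx⟩⟩) (fun x => c x i) fun x y => by
        refine congrFun (hinj (D x ⊓ D y) (inf_le_left.trans (hD x))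
          (a₁ := fun i => rres R inf_le_left (c x i))
          (a₂ := fun i => rres R inf_le_right (c y i)) ?_) i
        rw [← res_linComb b ((hD x).trans h), ← res_linComb b ((hD y).trans h), hc, hc,
          res_res, res_res]
  choose t ht using hglue
  refine ⟨t, sec_ext fun x hx => ⟨D ⟨x, hx⟩, hD _, hxD _, ?_⟩⟩
  rw [res_linComb, ← hc]
  congr 1
  funext i
  exact ht i _

end Glue

section Bijective

variable {X : Scheme.{u}}

lemma isLocalizingOn_unit {V : X.Opens} (hV : IsAffineOpen V) :
    IsLocalizingOn (SheafOfModules.unit X.ringCatSheaf) V := by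
  intro (f : Γ(X, V))
  have := hV.isLocalization_basicOpen f
  constructor
  · intro (s : Γ(X, X.basicOpen f))
    obtain ⟨n, t, h⟩ := IsLocalization.Away.surj f s
    refine ⟨n, t, ?_⟩
    have h' : algebraMap Γ(X, V) Γ(X, X.basicOpen f) t =
        algebraMap Γ(X, V) Γ(X, X.basicOpen f) (f ^ n) * s := by rw [← h, map_pow, mul_comm]
    exact h'
  · intro (t : Γ(X, V)) h
    have h' : algebraMap Γ(X, V) Γ(X, X.basicOpen f) t = algebraMap Γ(X, V) Γ(X, X.basicOpen f) 0 :=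
      Eq.trans h (map_zero _).symm
    obtain ⟨n, hn⟩ := IsLocalization.Away.exists_of_eq f h'
    exact ⟨n, hn.trans (mul_zero _)⟩

lemma isUnit_rres {V W : X.Opens} (h : RSec X.ringCatSheaf V) (hW : W ≤ X.basicOpen h) :
    IsUnit (rres X.ringCatSheaf (hW.trans (X.basicOpen_le h)) h) := by
  have h1 : IsUnit (rres X.ringCatSheaf (X.basicOpen_le h) h) :=
    X.toRingedSpace.isUnit_res_basicOpen h
  have h2 := h1.map (rres X.ringCatSheaf hW)
  exact (rres_rres (R := X.ringCatSheaf) (X.basicOpen_le h) hW h) ▸ h2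

lemma linComb_basicOpen_bijective {V : X.Opens} (hV : IsAffineOpen V) {M : X.Modules}
    (hM : IsLocalizingOn M V) (f h : Γ(X, V)) (hfh : X.basicOpen h ≤ X.basicOpen f) {r : ℕ}
    (b : Fin r → Γ(M, V))
    (hb : ∀ m : Γ(M, V), ∃ (k : ℕ) (c : Fin r → Γ(X, V)), f ^ k • m = ∑ i, c i • b i)
    (hb' : ∀ c : Fin r → Γ(X, V), ∑ i, c i • b i = 0 → ∀ i, ∃ k : ℕ, f ^ k * c i = 0) :
    Function.Bijective
      (linComb (R := X.ringCatSheaf) (M := M) b (X.basicOpen_le h)) := by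
  exact bijective_sum_smul_of_localization (R := Γ(X, V)) (M := Γ(M, V))
    (O' := Γ(X, X.basicOpen h)) (M' := Γ(M, X.basicOpen h))
    (rres X.ringCatSheaf (X.basicOpen_le h)) (res (R := X.ringCatSheaf) M (X.basicOpen_le h))
    (res_smul (R := X.ringCatSheaf) (M := M) (X.basicOpen_le h)) f h
    (isUnit_rres f hfh) (isUnit_rres h le_rfl) (isLocalizingOn_unit hV h).1 (hM h).1 (hM h).2
    b hb hb'

/-- Sections over an affine open subset `V` which become a basis after inverting `f` are a basis
over every open subset of `D(f)`. -/
lemma linComb_bijective {V : X.Opens} (hV : IsAffineOpen V) {M : X.Modules}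
    (hM : IsLocalizingOn M V) (f : Γ(X, V)) {r : ℕ} (b : Fin r → Γ(M, V))
    (hb : ∀ m : Γ(M, V), ∃ (k : ℕ) (c : Fin r → Γ(X, V)), f ^ k • m = ∑ i, c i • b i)
    (hb' : ∀ c : Fin r → Γ(X, V), ∑ i, c i • b i = 0 → ∀ i, ∃ k : ℕ, f ^ k * c i = 0)
    {W : X.Opens} (hW : W ≤ X.basicOpen f) :
    Function.Bijective
      (linComb (R := X.ringCatSheaf) (M := M) b (hW.trans (X.basicOpen_le f))) := by
  refine linComb_bijective_of_local _ _ fun W' hW' x hx => ?_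
  have hV' := (hW'.trans hW).trans (X.basicOpen_le f)
  obtain ⟨h, hh, hxh⟩ := hV.exists_basicOpen_le ⟨x, hx⟩ (hV' hx)
  exact ⟨X.basicOpen h, hh, hxh, linComb_basicOpen_bijective hV hM f h
    (hh.trans (hW'.trans hW)) b hb hb'⟩

end Bijective

/-! ### Local structure of Azumaya algebras -/

section SeparabilityElement

variable {R A R' S' G : Type u} [CommRing R] [Ring A] [Algebra R A] [CommRing R'] [Ring S']
  [AddCommGroup G]

/-- The identity `(a ⊗ 1) e = e (1 ⊗ a)` in `A ⊗ A` gives the commutation property of the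
corresponding element over a localization of the opposite algebra. -/
lemma sum_balanced_eq_of_commutes (τ : R →+* R') (ρ : Aᵐᵒᵖ →+* S') (φ : R' →+* S')
    (hφ : ∀ r s, φ r * s = s * φ r) (hρ : ∀ r, ρ (MulOpposite.op (algebraMap R A r)) = φ (τ r))
    (t : Finset (A × A)) (a : A)
    (ht : (a ⊗ₜ[R] (1 : A)) * (∑ l ∈ t, l.1 ⊗ₜ[R] l.2) =
      (∑ l ∈ t, l.1 ⊗ₜ[R] l.2) * ((1 : A) ⊗ₜ[R] a))
    (B : S' →+ S' →+ G) (hB : ∀ x r y, B (x * φ r) y = B x (φ r * y)) (c v : R') (s : S')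
    (hs : s = φ v * ρ (MulOpposite.op a)) :
    ∑ l : t, B (s * (ρ (MulOpposite.op l.1.2) * φ c)) (ρ (MulOpposite.op l.1.1)) =
      ∑ l : t, B (ρ (MulOpposite.op l.1.2) * φ c) (ρ (MulOpposite.op l.1.1) * s) := by
  let β : A →+ A →+ G := AddMonoidHom.mk' (fun x => AddMonoidHom.mk'
    (fun y => B (ρ (MulOpposite.op y) * φ (v * c)) (ρ (MulOpposite.op x)))
      (fun y y' => by simp [add_mul]))
    (fun x x' => by ext y; simp)
  let Φ : A ⊗[R] A →+ G := TensorProduct.liftAddHom β fun r x y => by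
    change B (ρ (MulOpposite.op y) * φ (v * c)) (ρ (MulOpposite.op (r • x))) =
      B (ρ (MulOpposite.op (r • y)) * φ (v * c)) (ρ (MulOpposite.op x))
    rw [Algebra.smul_def, Algebra.smul_def, MulOpposite.op_mul, MulOpposite.op_mul, map_mul ρ,
      map_mul ρ, hρ, ← hφ (τ r) (ρ (MulOpposite.op x)), ← hB, mul_assoc, mul_assoc, ← map_mul φ,
      ← map_mul φ, mul_comm (τ r)]
  have hΦ (x y : A) : Φ (x ⊗ₜ y) =
    B (ρ (MulOpposite.op y) * φ (v * c)) (ρ (MulOpposite.op x)) := rfl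
  have h := congrArg Φ ht
  simp only [Finset.mul_sum, Finset.sum_mul, Algebra.TensorProduct.tmul_mul_tmul, one_mul, mul_one,
    map_sum, hΦ, MulOpposite.op_mul, map_mul ρ] at h
  rw [Finset.sum_coe_sort t fun l => B (s * (ρ (MulOpposite.op l.2) * φ c)) (ρ (MulOpposite.op l.1)),
    Finset.sum_coe_sort t fun l => B (ρ (MulOpposite.op l.2) * φ c) (ρ (MulOpposite.op l.1) * s)]
  refine Eq.trans (Finset.sum_congr rfl fun l _ => ?_)
    (h.symm.trans (Finset.sum_congr rfl fun l _ => ?_))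
  · congr 2
    rw [hs, hφ, mul_assoc, map_mul, ← mul_assoc (φ v), hφ v, mul_assoc, mul_assoc]
  · rw [hs, ← mul_assoc, ← hφ v, mul_assoc, ← hB, mul_assoc, ← map_mul φ, mul_comm c]

end SeparabilityElement

section Azumaya

variable {X : Scheme.{u}}

lemma mem_basicOpen_of_notMem_primeIdealOf {V : X.Opens} (hV : IsAffineOpen V) {x : X}
    (hx : x ∈ V) {f : Γ(X, V)} (hf : f ∉ (hV.primeIdealOf ⟨x, hx⟩).asIdeal) :
    x ∈ X.basicOpen f := by
  have h : hV.primeIdealOf ⟨x, hx⟩ ∈ hV.fromSpec ⁻¹ᵁ X.basicOpen f := by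
    rw [hV.fromSpec_preimage_basicOpen]
    exact hf
  have h' : hV.fromSpec (hV.primeIdealOf ⟨x, hx⟩) ∈ X.basicOpen f := h
  rwa [hV.fromSpec_primeIdealOf] at h'

variable (𝒜 : SheafOfAlgebras X)

/-- The sections of `𝒜` and those of the underlying `𝒪_X`-module of `𝒜`, which is defined
through the opposite ring. -/
def sectionsEquiv (V : X.Opens) : 𝒜.sections V ≃ₗ[Γ(X, V)] Γ(𝒜.toModules, V) where
  toFun a := (MulOpposite.op a : (𝒜.sections V)ᵐᵒᵖ)
  invFun a := MulOpposite.unop (show (𝒜.sections V)ᵐᵒᵖ from a)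
  left_inv _ := rfl
  right_inv _ := rfl
  map_add' _ _ := rfl
  map_smul' r a := congrArg MulOpposite.op (𝒜.central V r a)

variable {𝒜}

/-- Over a suitable affine open subset `V` around `x`, the algebra `𝒜(V)` becomes free, and acquires
a separability element, after inverting functions which do not vanish at `x`. Both properties
descend from an étale neighbourhood on which `𝒜` is a matrix algebra, by flatness. -/
lemma exists_free_and_separability [IsLocallyNoetherian X] (h𝒜 : 𝒜.IsAzumaya) (x : X) :
    ∃ (V : X.Opens) (_ : IsAffineOpen V),
      (∃ f : Γ(X, V), x ∈ X.basicOpen f ∧ Module.Free (Localization (Submonoid.powers f))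
        (LocalizedModule.Away f (𝒜.sections V))) ∧
      ∃ f : Γ(X, V), x ∈ X.basicOpen f ∧ ∃ e : 𝒜.sections V ⊗[Γ(X, V)] 𝒜.sections V,
        (∀ a : 𝒜.sections V, (a ⊗ₜ[Γ(X, V)] (1 : 𝒜.sections V)) * e =
          e * ((1 : 𝒜.sections V) ⊗ₜ[Γ(X, V)] a)) ∧
        LinearMap.mul' Γ(X, V) (𝒜.sections V) e = algebraMap Γ(X, V) (𝒜.sections V) f := by
  obtain ⟨U, φ, V, hφ, n, _, _, hV, ⟨y, rfl⟩, hn, hψ⟩ := h𝒜.etale_locally_split x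
  let alg : Algebra Γ(X, V) Γ(U, ⊤) := (φ.appLE V ⊤ hφ).hom.toAlgebra
  obtain ⟨ψ⟩ := hψ
  have : IsNoetherianRing Γ(X, V) := IsLocallyNoetherian.component_noetherian ⟨V, hV⟩
  have : Module.Flat Γ(X, V) Γ(U, ⊤) := φ.flat_appLE hV (isAffineOpen_top U) hφ
  have : Module.Finite Γ(X, V) Γ(𝒜.toModules, V) := h𝒜.coherent.2 V hV
  have : Module.Finite Γ(X, V) (𝒜.sections V) := .equiv (sectionsEquiv 𝒜 V).symm
  have : Module.Flat Γ(U, ⊤) (Γ(U, ⊤) ⊗[Γ(X, V)] 𝒜.sections V) :=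
    .of_linearEquiv ψ.toLinearEquiv
  let q := ((isAffineOpen_top U).primeIdealOf ⟨y, trivial⟩).asIdeal
  have hq : q.comap (algebraMap Γ(X, V) Γ(U, ⊤)) =
      (hV.primeIdealOf ⟨φ y, hφ trivial⟩).asIdeal :=
    congrArg PrimeSpectrum.asIdeal
      (IsAffineOpen.comap_primeIdealOf_appLE V hV ⊤ (isAffineOpen_top U) hφ trivial)
  refine ⟨V, hV, ?_, ?_⟩
  · obtain ⟨f, hf, h⟩ := exists_free_away_of_flat (R := Γ(X, V)) (B := Γ(U, ⊤)) (𝒜.sections V) q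
    exact ⟨f, mem_basicOpen_of_notMem_primeIdealOf hV _ (hq ▸ hf), h⟩
  · obtain ⟨f, hf, h⟩ := exists_separability_of_flat hn ψ q
    exact ⟨f, mem_basicOpen_of_notMem_primeIdealOf hV _ (hq ▸ hf), h⟩

/-- Azumaya algebras are locally free as `𝒪_X`-modules. -/
lemma exists_frame [IsLocallyNoetherian X] (h𝒜 : 𝒜.IsAzumaya) (x : X) :
    ∃ U : X.Opens, x ∈ U ∧ Nonempty (Frame 𝒜.strOp U) := by
  obtain ⟨V, hV, ⟨f, hxf, hfree⟩, -⟩ := exists_free_and_separability h𝒜 x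
  have := h𝒜.coherent.1
  have hM : IsLocalizingOn 𝒜.toModules V := .of_isQuasicoherent _ hV
  have : Module.Finite Γ(X, V) Γ(𝒜.toModules, V) := h𝒜.coherent.2 V hV
  have : Module.Finite Γ(X, V) (𝒜.sections V) := .equiv (sectionsEquiv 𝒜 V).symm
  obtain ⟨r, b, hb, hb'⟩ := exists_basis_of_free_away (M := 𝒜.sections V) f
  let b' (i : Fin r) : Γ(𝒜.toModules, V) := sectionsEquiv 𝒜 V (b i)
  let b'' (i : Fin r) : RSec (sheafOp 𝒜.ring) V := MulOpposite.op (b i)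
  refine ⟨X.basicOpen f, hxf, ⟨⟨r, fun i => rres _ (X.basicOpen_le f) (b'' i), fun {W} h => ?_⟩⟩⟩
  have hbij := linComb_bijective hV hM f b' (fun m => ?_) (fun c hc => ?_) h
  · let L (c : Fin r → RSec X.ringCatSheaf W) : RSec (sheafOp 𝒜.ring) W :=
      linComb (R := X.ringCatSheaf) (M := 𝒜.toModules) b' (h.trans (X.basicOpen_le f)) c
    refine Eq.mp (congrArg Function.Bijective (funext fun c => ?_ : L = _)) hbij
    refine Eq.symm ?_
    refine Finset.sum_congr rfl fun i _ => ?_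
    refine (congrArg (· * _) (rres_rres (R := sheafOp 𝒜.ring) (X.basicOpen_le f) h (b'' i))).trans ?_
    exact (rapp_strOp_mul 𝒜 W (c i) _).symm
  · obtain ⟨k, c, hc⟩ := hb ((sectionsEquiv 𝒜 V).symm m)
    refine ⟨k, c, (sectionsEquiv 𝒜 V).symm.injective ?_⟩
    rw [map_smul, hc, map_sum]
    simp only [map_smul, b', LinearEquiv.symm_apply_apply]
  · refine hb' c ((sectionsEquiv 𝒜 V).injective ?_)
    rw [map_sum, map_zero, ← hc]
    simp only [map_smul, b']

/-- With `∑ a_l ⊗ a'_l` in `𝒜(V) ⊗ 𝒜(V)` commuting with `𝒜(V)` and with product `f`, the element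
`∑ a'_l f⁻¹ ⊗ a_l` is a separability element of the opposite algebra over `D(f)`: the factors are
interchanged as the multiplication is reversed. -/
lemma exists_separability [IsLocallyNoetherian X] (h𝒜 : 𝒜.IsAzumaya) (x : X) :
    ∃ U : X.Opens, x ∈ U ∧ Nonempty (Separability 𝒜.strOp U) := by
  obtain ⟨V, hV, -, f, hxf, e, he, hmul⟩ := exists_free_and_separability h𝒜 x
  have := h𝒜.coherent.1
  have hM : IsLocalizingOn 𝒜.toModules V := .of_isQuasicoherent _ hV
  obtain ⟨t, rfl⟩ := TensorProduct.exists_finset e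
  obtain ⟨c, hc⟩ := (isUnit_rres f le_rfl).exists_right_inv
  let U := X.basicOpen f
  let i (a : 𝒜.sections V) : RSec (sheafOp 𝒜.ring) V := MulOpposite.op a
  refine ⟨U, hxf, ⟨⟨t, fun l => rres _ (X.basicOpen_le f) (i l.1.2) * rapp 𝒜.strOp U c,
    fun l => rres _ (X.basicOpen_le f) (i l.1.1), ?_, fun {W} hW s {z} hz => ?_⟩⟩⟩
  · have h1 : ∑ l ∈ t, i l.2 * i l.1 = rapp 𝒜.strOp V f := by
      have h2 : ∑ l ∈ t, l.1 * l.2 = algebraMap Γ(X, V) (𝒜.sections V) f := by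
        rw [← hmul, map_sum]
        rfl
      refine Eq.trans ?_ (congrArg i h2)
      exact (map_sum (MulOpposite.opAddEquiv : 𝒜.sections V ≃+ _) _ _).symm
    have h3 := congrArg (fun a => rres (sheafOp 𝒜.ring) (X.basicOpen_le f) a * rapp 𝒜.strOp U c) h1
    rw [Finset.sum_coe_sort t fun l => rres (sheafOp 𝒜.ring) (X.basicOpen_le f) (i l.2) *
      rapp 𝒜.strOp U c * rres (sheafOp 𝒜.ring) (X.basicOpen_le f) (i l.1)]
    refine Eq.trans ?_ (h3.trans ?_)
    · simp only [map_sum, Finset.sum_mul]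
      refine Finset.sum_congr rfl fun l _ => ?_
      rw [map_mul, mul_assoc, mul_assoc, rapp_strOp_mul]
    · refine (congrArg (· * _) (rres_rapp 𝒜.strOp (X.basicOpen_le f) f)).trans ?_
      exact (map_mul (rapp 𝒜.strOp U) _ c).symm.trans ((congrArg _ hc).trans (map_one _))
  · obtain ⟨h, hhW, hzh⟩ := hV.exists_basicOpen_le ⟨z, hz⟩ (X.basicOpen_le f (hW hz))
    refine ⟨X.basicOpen h, hhW, hzh, fun G _ B hB => ?_⟩
    -- over `D(h)`, the section `s` is a fraction with numerator `a` over `V`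
    obtain ⟨k, a, ha⟩ := (hM h).1 (rres (sheafOp 𝒜.ring) hhW s)
    obtain ⟨v, hv⟩ := ((isUnit_rres h le_rfl).pow k).exists_left_inv
    let c' := rres X.ringCatSheaf (hhW.trans hW) c
    let a' : 𝒜.sections V := (sectionsEquiv 𝒜 V).symm a
    have hs : rres (sheafOp 𝒜.ring) hhW s = rapp 𝒜.strOp _ v *
        rres (sheafOp 𝒜.ring) (X.basicOpen_le h) (i a') := by
      have ha' : rres (sheafOp 𝒜.ring) (X.basicOpen_le h) (i a') =
        rapp 𝒜.strOp _ (rres X.ringCatSheaf (X.basicOpen_le h) (h ^ k)) *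
          rres (sheafOp 𝒜.ring) hhW s := ha
      rw [ha', ← mul_assoc, ← map_mul]
      refine Eq.symm ((congrArg (fun r => rapp 𝒜.strOp _ r * _) ?_).trans
        ((congrArg (· * _) (map_one _)).trans (one_mul _)))
      exact (congrArg (v * ·) (map_pow _ h k)).trans hv
    have key := sum_balanced_eq_of_commutes (R := Γ(X, V)) (A := 𝒜.sections V)
      (R' := Γ(X, X.basicOpen h)) (S' := RSec (sheafOp 𝒜.ring) (X.basicOpen h))
      (rres X.ringCatSheaf (X.basicOpen_le h)) (rres (sheafOp 𝒜.ring) (X.basicOpen_le h))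
      (rapp 𝒜.strOp _) (rapp_strOp_mul 𝒜 _) (fun r => rres_rapp 𝒜.strOp (X.basicOpen_le h) r)
      t a' (he a') B hB c' v _ hs
    have hx (l : t) : rres (sheafOp 𝒜.ring) (hhW.trans hW)
        (rres _ (X.basicOpen_le f) (i l.1.2) * rapp 𝒜.strOp U c) =
        rres (sheafOp 𝒜.ring) (X.basicOpen_le h) (i l.1.2) * rapp 𝒜.strOp _ c' :=
      (map_mul _ _ _).trans (congrArg₂ (· * ·)
        (rres_rres (R := sheafOp 𝒜.ring) (X.basicOpen_le f) (hhW.trans hW) (i l.1.2))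
        (rres_rapp 𝒜.strOp (hhW.trans hW) c))
    have hy (l : t) : rres (sheafOp 𝒜.ring) (hhW.trans hW)
        (rres _ (X.basicOpen_le f) (i l.1.1)) =
        rres (sheafOp 𝒜.ring) (X.basicOpen_le h) (i l.1.1) :=
      rres_rres (R := sheafOp 𝒜.ring) (X.basicOpen_le f) (hhW.trans hW) (i l.1.1)
    simp only [hx, hy]
    exact key

end Azumaya

end AzumayaGen

end

theorem proposition6p4 (X : Scheme.{u}) [AlgebraicGeometry.IsNoetherian X]
    (𝒜 : AzumayaGen.SheafOfAlgebras X) (h𝒜 : 𝒜.IsAzumaya) (Z : Set X) (hZ : IsClosed Z)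
    [HasDerivedCategory.{w₁} X.Modules] [HasDerivedCategory.{w₂} 𝒜.Mod] :
    ∃ F : DerivedCategory X.Modules ⥤ DerivedCategory 𝒜.Mod,
      Nonempty (DerivedCategory.Q ⋙ F ≅ 𝒜.tensorComplex ⋙ DerivedCategory.Q) ∧
        ∀ G : DerivedCategory X.Modules,
          AzumayaGen.IsClassicalGenerator (AzumayaGen.DbCoh X Z) G →
            AzumayaGen.IsClassicalGenerator (𝒜.DbCoh Z) (F.obj G) := by
  have hframe := AzumayaGen.exists_frame h𝒜
  have : PreservesFiniteLimits 𝒜.tensor :=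
    AzumayaGen.preservesFiniteLimits_of_frames 𝒜.tensorAdjunction hframe
  have : PreservesFiniteColimits 𝒜.tensor :=
    have := 𝒜.tensorAdjunction.leftAdjoint_preservesColimits
    inferInstance
  have : PreservesFiniteLimits 𝒜.forgetful :=
    have := 𝒜.tensorAdjunction.rightAdjoint_preservesLimits
    inferInstance
  have : PreservesFiniteColimits 𝒜.forgetful :=
    AzumayaGen.preservesFiniteColimits_restrictScalars 𝒜.tensorAdjunction
  have : 𝒜.forgetful.Faithful :=
    AzumayaGen.faithful_restrictScalars (φ := 𝒜.strOp)
  exact ⟨𝒜.tensor.mapDerivedCategory, ⟨𝒜.tensor.mapDerivedCategoryFactors⟩, fun G hG =>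
    AzumayaGen.isClassicalGenerator_mapDerivedCategory 𝒜.tensorAdjunction
      (AzumayaGen.cohSupportedIn X Z) (fun N hN => AzumayaGen.cohSupportedIn_tensor 𝒜 hframe hN)
      (AzumayaGen.filteredCounitSplit_of_cover 𝒜.tensorAdjunction
        (AzumayaGen.exists_separability h𝒜)) hG⟩
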